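/- Let $k$ be an algebraically closed field of characteristic zero and let $E$ be an elliptic curve over $k$. Let $\mathrm{Bir}(E\times\mathbb{P}^1)$ be the group of birational automorphisms over $k$ of the product $E\times\mathbb{P}^1$ (over $k$) of $E$ with the projective line. Then $\mathrm{Bir}(E\times\mathbb{P}^1)$ is not a Jordan group. Here a group $B$ is called a Jordan group if there is a positive integer $J$ such that every finite subgroup $B_1$ of $B$ contains a commutative subgroup whose index in $B_1$ is at most $J$ (requiring the commutative subgroup to be normal in $B_1$ gives an equivalent notion). -/

import Mathlib

universe u

open CategoryTheory AlgebraicGeometry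

/-- A group `B` is a Jordan group if there is a positive integer `J` such that every finite
subgroup `H` of `B` contains a commutative subgroup `A` of index at most `J` in `H`. Requiring `A`
to be normal in `H` gives the same class of groups, see `isJordanGroup_iff_normal`. -/
def IsJordanGroup (B : Type*) [Group B] : Prop :=
  ∃ J : ℕ, 0 < J ∧ ∀ H : Subgroup B, Finite H →
    ∃ A : Subgroup H, (∀ x ∈ A, ∀ y ∈ A, x * y = y * x) ∧ A.index ≤ J

theorem isJordanGroup_iff_normal (B : Type*) [Group B] :
    IsJordanGroup B ↔ ∃ J : ℕ, 0 < J ∧ ∀ H : Subgroup B, Finite H →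
      ∃ A : Subgroup H, A.Normal ∧ (∀ x ∈ A, ∀ y ∈ A, x * y = y * x) ∧ A.index ≤ J := by
  constructor
  · rintro ⟨J, hJ, h⟩
    refine ⟨J.factorial, J.factorial_pos, fun H hH => ?_⟩
    obtain ⟨A, hA, hi⟩ := h H hH
    refine ⟨A.normalCore, inferInstance,
      fun x hx y hy => hA x (A.normalCore_le hx) y (A.normalCore_le hy), ?_⟩
    have hd : A.normalCore.index ∣ A.index.factorial := by
      rw [Subgroup.normalCore_eq_ker, Subgroup.index_ker, Subgroup.index_eq_card, ← Nat.card_perm]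
      exact Subgroup.card_subgroup_dvd_card _
    exact (Nat.le_of_dvd (Nat.factorial_pos _) hd).trans (Nat.factorial_le hi)
  · rintro ⟨J, hJ, h⟩
    refine ⟨J, hJ, fun H hH => ?_⟩
    obtain ⟨A, -, hA⟩ := h H hH
    exact ⟨A, hA⟩

/-- Dominant rational maps from `X` to itself over `S`, where `s : X ⟶ S` is the structure
morphism: `f` followed by `s` is the rational map given by `s`. -/
structure DominantRationalSelfMap {X S : Scheme.{u}} (s : X ⟶ S) where
  toRationalMap : X ⤏ X
  isDominant : toRationalMap.IsDominant
  comp_structure : toRationalMap.compHom s = s.toRationalMap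

attribute [instance] DominantRationalSelfMap.isDominant

namespace DominantRationalSelfMap
variable {X S : Scheme.{u}} {s : X ⟶ S}

@[ext]
theorem ext {f g : DominantRationalSelfMap s} (h : f.toRationalMap = g.toRationalMap) :
    f = g := by
  cases f; cases g; cases h; rfl

variable [IrreducibleSpace X]

/-- The product `f * g` is the composition `f ∘ g`, that is, first `g` and then `f`. -/
noncomputable instance : Monoid (DominantRationalSelfMap s) where
  mul f g :=
    { toRationalMap := g.toRationalMap.comp f.toRationalMap
      isDominant := inferInstance
      comp_structure := by
        have : Nonempty S := ⟨s (Classical.arbitrary X)⟩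
        rw [← Scheme.RationalMap.comp_toRationalMap, Scheme.RationalMap.comp_assoc,
          Scheme.RationalMap.comp_toRationalMap, f.comp_structure,
          Scheme.RationalMap.comp_toRationalMap, g.comp_structure] }
  one :=
    { toRationalMap := Scheme.RationalMap.id X
      isDominant := inferInstance
      comp_structure := by rw [Scheme.RationalMap.id_compHom] }
  mul_assoc f g h := ext (Scheme.RationalMap.comp_assoc _ _ _).symm
  one_mul f := ext (Scheme.RationalMap.comp_id _)
  mul_one f := ext (Scheme.RationalMap.id_comp _)

end DominantRationalSelfMap

/-- The group of birational automorphisms of `X` over `S`: the dominant rational self-maps of `X`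
over `S` which have an inverse rational map. -/
abbrev Bir {X S : Scheme.{u}} (s : X ⟶ S) [IrreducibleSpace X] : Type u :=
  (DominantRationalSelfMap s)ˣ

/-- The structure morphism `Proj 𝒜 ⟶ Spec k` of the projective spectrum of a graded `k`-algebra. -/
noncomputable def projToSpec (k : Type u) [Field k] {A : Type u} [CommRing A] [Algebra k A]
    (𝒜 : ℕ → Submodule k A) [GradedAlgebra 𝒜] : Proj 𝒜 ⟶ Spec (.of k) :=
  Proj.toSpecZero 𝒜 ≫ Spec.map (CommRingCat.ofHom (algebraMap k (𝒜 0)))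

theorem irreducibleSpace_proj (k : Type u) [Field k] {A : Type u} [CommRing A] [Algebra k A]
    (𝒜 : ℕ → Submodule k A) [GradedAlgebra 𝒜] [IsDomain A] {m : ℕ} (hm : 0 < m) {f : A}
    (hf : f ∈ 𝒜 m) (hf0 : f ≠ 0) : IrreducibleSpace (Proj 𝒜) := by
  let η : ProjectiveSpectrum 𝒜 := ⟨⊥, by simpa using! Ideal.isPrime_bot, fun h => hf0 (by
    simpa using! h (HomogeneousIdeal.mem_irrelevant_of_mem 𝒜 hm hf))⟩
  have h : closure {η} = Set.univ := Set.eq_univ_of_forall fun x =>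
    (ProjectiveSpectrum.le_iff_mem_closure 𝒜 η x).mp
      ((ProjectiveSpectrum.as_ideal_le_as_ideal 𝒜 η x).mp bot_le)
  have h' : IsIrreducible (Set.univ : Set (ProjectiveSpectrum 𝒜)) :=
    h ▸ isIrreducible_singleton.closure
  exact (irreducibleSpace_def _).mpr h'

section

open Limits MvPolynomial

attribute [local instance] MvPolynomial.gradedAlgebra
variable (k : Type u) [Field k]

/-- The projective line over `k`, as `Proj k[X, Y]` with the usual grading. -/
noncomputable abbrev projectiveLine : Scheme.{u} := Proj (homogeneousSubmodule (Fin 2) k)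

/-- The structure morphism of the projective line. -/
noncomputable abbrev projectiveLineToSpec : projectiveLine k ⟶ Spec (.of k) :=
  projToSpec k (homogeneousSubmodule (Fin 2) k)

theorem X_mem (i : Fin 2) : X i ∈ homogeneousSubmodule (Fin 2) k 1 := isHomogeneous_X k i

instance : IrreducibleSpace (projectiveLine k) :=
  irreducibleSpace_proj k (homogeneousSubmodule (Fin 2) k) one_pos (X_mem k 0)
    (X_ne_zero (R := k) (0 : Fin 2))

/-- The substitution `X ↦ t`, `Y ↦ 1` from `k[X, Y]` to `k[t]`. -/
noncomputable def setYOne : MvPolynomial (Fin 2) k →+* Polynomial k :=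
  (aeval ![Polynomial.X, 1]).toRingHom

theorem isUnit_setYOne : IsUnit (setYOne k (X 1)) := by simp [setYOne]

/-- The extension of `setYOne` to the localization at `Y`. -/
noncomputable def setYOneLocalized : Localization.Away (X 1 : MvPolynomial (Fin 2) k) →+* Polynomial k :=
  IsLocalization.Away.lift (X 1) (isUnit_setYOne k)

/-- Dehomogenization, on the coordinate ring of the chart `Y ≠ 0`. -/
noncomputable def dehomogenize :
    HomogeneousLocalization.Away (homogeneousSubmodule (Fin 2) k) (X 1) →+* Polynomial k :=
  (setYOneLocalized k).comp (algebraMap _ (Localization.Away (X 1 : MvPolynomial (Fin 2) k)))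

theorem dehomogenize_mk (n : ℕ) (a : MvPolynomial (Fin 2) k) (ha) :
    dehomogenize k (.mk _ (X_mem k 1) n a ha) = aeval ![Polynomial.X, 1] a := by
  change _ = setYOne k a
  have hL (p) : setYOneLocalized k (algebraMap _ _ p) = setYOne k p :=
    IsLocalization.Away.lift_eq _ (isUnit_setYOne k) p
  have hX : setYOne k (X 1 ^ n) = 1 := by simp [setYOne]
  rw [dehomogenize, RingHom.comp_apply, HomogeneousLocalization.algebraMap_apply,
    HomogeneousLocalization.Away.val_mk, ← mul_one (setYOneLocalized k _), ← hX, ← hL, ← map_mul,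
    Localization.mk_eq_mk']
  exact (congrArg (setYOneLocalized k) (IsLocalization.mk'_spec _ _ _)).trans (hL a)

theorem dehomogenize_injective : Function.Injective (dehomogenize k) := by
  rw [injective_iff_map_eq_zero]
  intro z hz
  obtain ⟨n, a, ha, rfl⟩ := HomogeneousLocalization.Away.mk_surjective _ (X_mem k 1) z
  rw [dehomogenize_mk] at hz
  have : a = 0 := by
    rw [← Polynomial.homogenize_eq_of_isHomogeneous (ha : a.IsHomogeneous (n • 1)) hz]
    simp
  subst this
  apply HomogeneousLocalization.val_injective
  rw [HomogeneousLocalization.Away.val_mk, Localization.mk_zero, HomogeneousLocalization.val_zero]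

/-- The chart of the projective line given by the affine line. -/
noncomputable def fromAffineLine : Spec (.of (Polynomial k)) ⟶ projectiveLine k :=
  Spec.map (CommRingCat.ofHom (dehomogenize k)) ≫
    Proj.awayι (homogeneousSubmodule (Fin 2) k) (X 1) (X_mem k 1) one_pos

theorem fromAffineLine_comp : fromAffineLine k ≫ projectiveLineToSpec k = 
    Spec.map (CommRingCat.ofHom (algebraMap k (Polynomial k))) := by
  rw [fromAffineLine, projectiveLineToSpec, projToSpec, Category.assoc, Proj.awayι_toSpecZero_assoc,
    ← Spec.map_comp, ← Spec.map_comp]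
  congr 1
  ext x : 2
  change dehomogenize k (HomogeneousLocalization.fromZeroRingHom _ _ (algebraMap k _ x)) = algebraMap _ _ x
  have : HomogeneousLocalization.fromZeroRingHom (homogeneousSubmodule (Fin 2) k) (.powers (X 1)) (algebraMap k _ x) = 
    HomogeneousLocalization.Away.mk _ (X_mem k 1) 0 (C x) (by simpa only [zero_smul] using! isHomogeneous_C _ _) := by
     apply HomogeneousLocalization.val_injective
     simp [HomogeneousLocalization.fromZeroRingHom]
     rfl
  rw [this, dehomogenize_mk]
  simp

instance : IsDominant (fromAffineLine k) := by
  have : IsDominant (Spec.map (CommRingCat.ofHom (dehomogenize k))) := by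
    refine ⟨(PrimeSpectrum.denseRange_comap_iff_ker_le_nilRadical (dehomogenize k)).mpr ?_⟩
    rw [(RingHom.injective_iff_ker_eq_bot _).mp (dehomogenize_injective k)]
    exact bot_le
  have : Nonempty (Spec (.of (Polynomial k))) := inferInstance
  have : IsDominant (Proj.awayι (homogeneousSubmodule (Fin 2) k) (X 1) (X_mem k 1) one_pos) := by
    refine ⟨IsOpen.dense (Scheme.Hom.isOpenEmbedding _).isOpen_range ?_⟩
    exact ⟨_, Spec.map (CommRingCat.ofHom (dehomogenize k)) (Classical.arbitrary _), rfl⟩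
  unfold fromAffineLine
  infer_instance

theorem geometricallyIrreducible_affineLine :
    GeometricallyIrreducible (Spec.map (CommRingCat.ofHom (algebraMap k (Polynomial k)))) := by
  have : MorphismProperty.IsStableUnderBaseChange (C := Scheme.{u}) @GeometricallyIrreducible := inferInstance
  have : MorphismProperty.RespectsIso (C := Scheme.{u}) @GeometricallyIrreducible := MorphismProperty.IsStableUnderBaseChange.respectsIso
  have h : GeometricallyIrreducible (Spec.map (CommRingCat.ofHom (C : k →+* MvPolynomial PUnit.{u+1} k))) := by
    have := AffineSpace.SpecIso_inv_over (n := PUnit.{u+1}) (.of k)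
    refine this ▸ (MorphismProperty.cancel_left_of_respectsIso (@GeometricallyIrreducible : MorphismProperty Scheme.{u}) _ _).mpr inferInstance
  let e : CommRingCat.of (Polynomial k) ≅ .of (MvPolynomial PUnit.{u+1} k) :=
    (MvPolynomial.uniqueAlgEquiv k PUnit.{u+1}).symm.toRingEquiv.toCommRingCatIso
  have he : Spec.map (CommRingCat.ofHom (C : k →+* MvPolynomial PUnit.{u+1} k)) = 
    Spec.map e.hom ≫ Spec.map (CommRingCat.ofHom (algebraMap k (Polynomial k))) := by
    rw [← Spec.map_comp]
    congr 1
    ext x : 2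
    simp [e]
  rw [he] at h
  exact (MorphismProperty.cancel_left_of_respectsIso (@GeometricallyIrreducible : MorphismProperty Scheme.{u}) _ _).mp h

theorem irreducibleSpace_prod_projectiveLine {X : Scheme.{u}} (s : X ⟶ Spec (.of k))
   [IrreducibleSpace X] : IrreducibleSpace ↥(pullback s (projectiveLineToSpec k)) := by
  have := geometricallyIrreducible_affineLine k
  let j := pullback.map s (Spec.map (CommRingCat.ofHom (algebraMap k (Polynomial k)))) s (projectiveLineToSpec k) 
    (𝟙 _) (fromAffineLine k) (𝟙 _) (by simp) (by rw [fromAffineLine_comp, Category.comp_id])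
  have hj : DenseRange j := by
    rw [DenseRange, Scheme.Pullback.range_map]
    simpa using (fromAffineLine k).denseRange.preimage (pullback.snd s (projectiveLineToSpec k)).isOpenMap
  have h := (IrreducibleSpace.isIrreducible_univ _).image j j.continuous.continuousOn
  rw [Set.image_univ] at h
  have h := h.closure
  rw [hj.closure_range] at h
  exact (irreducibleSpace_def _).mpr h
end

namespace WeierstrassCurve

open MvPolynomial DirectSum

variable {k : Type u} [Field k] (W : WeierstrassCurve k)

theorem irreducible_projectivePolynomial : Irreducible W.toProjective.polynomial := by
  let e := finSuccEquiv k 2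
  let R := MvPolynomial (Fin 2) k
  let a : R := C W.a₂ * X 1
  let b : R := C W.a₄ * X 1 ^ 2 - C W.a₁ * X 0 * X 1
  let c : R := C W.a₆ * X 1 ^ 3 - X 0 ^ 2 * X 1 - C W.a₃ * X 0 * X 1 ^ 2
  let f : Polynomial R := .X ^ 3 + (.C a * .X ^ 2 + .C b * .X + .C c)
  have hC (x : k) : e (C x) = .C (C x) := by simp [e, finSuccEquiv_apply]
  have h0 : e (X 0) = .X := finSuccEquiv_X_zero
  have h1 : e (X 1) = .C (X 0) := finSuccEquiv_X_succ (j := 0)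
  have h2 : e (X 2) = .C (X 1) := finSuccEquiv_X_succ (j := 1)
  have hf : e (-W.toProjective.polynomial) = f := by
    simp only [Projective.polynomial, map_neg, map_sub, map_add, map_mul, map_pow, hC, h0, h1, h2,
      f, a, b, c]
    ring
  have hlt : (.C a * .X ^ 2 + .C b * .X + .C c : Polynomial R).degree < 3 :=
    Polynomial.degree_quadratic_lt
  have hmonic : f.Monic := Polynomial.monic_X_pow_add (n := 3) hlt
  have hdeg : f.natDegree = 3 := Polynomial.natDegree_eq_of_degree_eq_some
    ((Polynomial.degree_add_eq_left_of_degree_lt (by simpa using hlt)).trans (by simp))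
  have hcoeff (a b c : R) (n : ℕ) : (.X ^ 3 + (.C a * .X ^ 2 + .C b * .X + .C c) :
      Polynomial R).coeff n = (if n = 3 then 1 else 0) + ((if n = 2 then a else 0) +
        (if n = 1 then b else 0) + if n = 0 then c else 0) := by
    simp [Polynomial.coeff_X_pow, Polynomial.coeff_X, Polynomial.coeff_C, eq_comm]
  have hc0 : f.coeff 0 = c := (hcoeff a b c 0).trans (by simp)
  have hc1 : f.coeff 1 = b := (hcoeff a b c 1).trans (by simp)
  have hc2 : f.coeff 2 = a := (hcoeff a b c 2).trans (by simp)
  have hZ : Prime (X 1 : R) := X_prime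
  have hP : (Ideal.span {(X 1 : R)}).IsPrime := (Ideal.span_singleton_prime hZ.ne_zero).mpr hZ
  have hE : f.IsEisensteinAt (Ideal.span {(X 1 : R)}) := by
    refine hmonic.isEisensteinAt_of_mem_of_notMem hP.ne_top ?_ ?_
    · intro n hn
      rw [hdeg] at hn
      rw [Ideal.mem_span_singleton]
      interval_cases n
      · exact ⟨C W.a₆ * X 1 ^ 2 - X 0 ^ 2 - C W.a₃ * X 0 * X 1, by rw [hc0]; ring⟩
      · exact ⟨C W.a₄ * X 1 - C W.a₁ * X 0, by rw [hc1]; ring⟩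
      · exact ⟨C W.a₂, by rw [hc2]; ring⟩
    · rw [Ideal.span_singleton_pow, Ideal.mem_span_singleton]
      rintro ⟨q, hq⟩
      have hq : X 1 * (C W.a₆ * X 1 ^ 2 - X 0 ^ 2 - C W.a₃ * X 0 * X 1) = X 1 * (X 1 * q) := by
        rw [← mul_assoc, ← pow_two, ← hq, hc0]; ring
      have hq := congrArg (eval ![1, 0]) (mul_left_cancel₀ hZ.ne_zero hq)
      simp at hq
  have hirr := hE.irreducible hP hmonic.isPrimitive (by omega)
  rw [← hf, MulEquiv.irreducible_iff] at hirr
  exact (Associated.refl _).neg_left.irreducible hirr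

theorem isHomogeneous_projectivePolynomial : W.toProjective.polynomial.IsHomogeneous 3 := by
  have hX (i : Fin 3) := isHomogeneous_X k i
  have hC (a : k) := isHomogeneous_C (Fin 3) a
  unfold Projective.polynomial
  refine .sub (.add (.add ?_ ?_) ?_) (.add (.add (.add ?_ ?_) ?_) ?_)
  · exact ((hX 1).pow 2).mul (hX 2)
  · exact (((hC _).mul (hX 0)).mul (hX 1)).mul (hX 2)
  · exact ((hC _).mul (hX 1)).mul ((hX 2).pow 2)
  · exact (hX 0).pow 3
  · exact ((hC _).mul ((hX 0).pow 2)).mul (hX 2)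
  · exact ((hC _).mul (hX 0)).mul ((hX 2).pow 2)
  · exact (hC _).mul ((hX 2).pow 3)

/-- The homogeneous coordinate ring `k[X, Y, Z] / (F)` of the plane cubic with Weierstrass
equation `F = Y²Z + a₁XYZ + a₃YZ² - (X³ + a₂X²Z + a₄XZ² + a₆Z³) = 0`. -/
abbrev HomogeneousCoordinateRing : Type u :=
  MvPolynomial (Fin 3) k ⧸ Ideal.span {W.toProjective.polynomial}

/-- The classes of the homogeneous polynomials of degree `n`. -/
noncomputable def homogeneousPart (n : ℕ) : Submodule k W.HomogeneousCoordinateRing :=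
  (homogeneousSubmodule (Fin 3) k n).map
    (Ideal.Quotient.mkₐ k (Ideal.span {W.toProjective.polynomial})).toLinearMap

instance : SetLike.GradedMonoid W.homogeneousPart where
  one_mem := ⟨1, isHomogeneous_one _ _, map_one (Ideal.Quotient.mkₐ k _)⟩
  mul_mem := by
    rintro i j _ _ ⟨p, hp, rfl⟩ ⟨q, hq, rfl⟩
    exact ⟨p * q, hp.mul hq, map_mul (Ideal.Quotient.mkₐ k _) _ _⟩

/-- The decomposition into homogeneous parts, before passing to the quotient. -/
noncomputable def decomposeAux : MvPolynomial (Fin 3) k →ₐ[k] ⨁ n, W.homogeneousPart n :=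
  aeval fun i => DirectSum.of (fun n => W.homogeneousPart n) 1
    ⟨Ideal.Quotient.mkₐ k _ (X i), ⟨X i, isHomogeneous_X _ _, rfl⟩⟩

theorem decomposeAux_X (i : Fin 3) :
    W.decomposeAux (X i) = DirectSum.of (fun n => W.homogeneousPart n) 1
      ⟨Ideal.Quotient.mkₐ k _ (X i), ⟨X i, isHomogeneous_X _ _, rfl⟩⟩ := aeval_X _ _

theorem coeAlgHom_decomposeAux (p : MvPolynomial (Fin 3) k) :
    DirectSum.coeAlgHom W.homogeneousPart (W.decomposeAux p) = Ideal.Quotient.mkₐ k _ p := by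
  revert p
  refine AlgHom.congr_fun (φ₁ := (DirectSum.coeAlgHom W.homogeneousPart).comp W.decomposeAux) ?_
  ext i
  simp [decomposeAux]

theorem decomposeAux_monomial (d : Fin 3 →₀ ℕ) :
    ∃ x, W.decomposeAux (monomial d 1) =
      DirectSum.of (fun n => W.homogeneousPart n) d.degree x := by
  induction d using Finsupp.induction_linear with
  | zero =>
    rw [map_zero, monomial_zero', C_1, map_one]
    exact ⟨⟨1, SetLike.GradedOne.one_mem⟩, rfl⟩
  | add f g hf hg =>
    obtain ⟨x, hx⟩ := hf
    obtain ⟨y, hy⟩ := hg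
    rw [map_add, ← one_mul (1 : k), ← monomial_mul, map_mul, hx, hy, DirectSum.of_mul_of]
    exact ⟨_, rfl⟩
  | single i n =>
    induction n with
    | zero =>
      rw [Finsupp.single_zero, map_zero, monomial_zero', C_1, map_one]
      exact ⟨⟨1, SetLike.GradedOne.one_mem⟩, rfl⟩
    | succ n ih =>
      obtain ⟨x, hx⟩ := ih
      rw [Finsupp.single_add, map_add, ← one_mul (1 : k), ← monomial_mul, map_mul, hx]
      rw [Finsupp.degree_single i 1, ← X, W.decomposeAux_X, DirectSum.of_mul_of]
      exact ⟨_, rfl⟩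

theorem decomposeAux_apply {n : ℕ} {p : MvPolynomial (Fin 3) k} (hp : p.IsHomogeneous n) :
    W.decomposeAux p = DirectSum.of (fun n => W.homogeneousPart n) n
      ⟨Ideal.Quotient.mkₐ k _ p, ⟨p, hp, rfl⟩⟩ := by
  have h : ∃ x, W.decomposeAux p = DirectSum.of (fun n => W.homogeneousPart n) n x := by
    suffices W.decomposeAux p ∈
        LinearMap.range (DirectSum.lof k ℕ (fun n => W.homogeneousPart n) n) by
      obtain ⟨x, hx⟩ := this
      exact ⟨x, hx.symm⟩
    rw [p.as_sum, map_sum]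
    refine Submodule.sum_mem _ fun d hd => ?_
    obtain ⟨x, hx⟩ := W.decomposeAux_monomial d
    have hd : d.degree = n := by
      by_contra h
      exact mem_support_iff.mp hd (hp.coeff_eq_zero h)
    subst hd
    rw [← mul_one (coeff d p), ← smul_eq_mul, ← smul_monomial, map_smul, hx]
    exact Submodule.smul_mem _ _ ⟨x, rfl⟩
  obtain ⟨x, hx⟩ := h
  have h := W.coeAlgHom_decomposeAux p
  rw [hx, DirectSum.coeAlgHom_of] at h
  rw [hx]
  congr 1
  exact Subtype.ext h

theorem decomposeAux_eq_zero (a : MvPolynomial (Fin 3) k)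
    (ha : a ∈ Ideal.span {W.toProjective.polynomial}) : W.decomposeAux a = 0 := by
  obtain ⟨b, rfl⟩ := Ideal.mem_span_singleton.mp ha
  have h : (⟨Ideal.Quotient.mkₐ k _ W.toProjective.polynomial, ⟨_, W.isHomogeneous_projectivePolynomial, rfl⟩⟩ :
      W.homogeneousPart 3) = 0 :=
    Subtype.ext (Ideal.Quotient.eq_zero_iff_mem.mpr (Ideal.mem_span_singleton_self _))
  rw [map_mul, W.decomposeAux_apply W.isHomogeneous_projectivePolynomial, h, map_zero, zero_mul]

noncomputable instance : GradedAlgebra W.homogeneousPart :=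
  GradedAlgebra.ofAlgHom _ (Ideal.Quotient.liftₐ _ W.decomposeAux W.decomposeAux_eq_zero)
    (by
      apply Ideal.Quotient.algHom_ext
      ext i
      exact W.coeAlgHom_decomposeAux (X i))
    (by
      rintro n ⟨_, p, hp, rfl⟩
      exact W.decomposeAux_apply hp)

instance : IsDomain W.HomogeneousCoordinateRing :=
  (Ideal.Quotient.isDomain_iff_prime _).mpr
    ((Ideal.span_singleton_prime W.irreducible_projectivePolynomial.ne_zero).mpr
      W.irreducible_projectivePolynomial.prime)

theorem mk_Z_ne_zero :
   Ideal.Quotient.mkₐ k (Ideal.span {W.toProjective.polynomial}) (X 2) ≠ 0 := by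
  intro h
  obtain ⟨q, hq⟩ := Ideal.mem_span_singleton.mp (Ideal.Quotient.eq_zero_iff_mem.mp h)
  have hd := congrArg totalDegree hq
  have hq0 : q ≠ 0 := by rintro rfl; simp at hq
  rw [totalDegree_mul_of_isDomain W.irreducible_projectivePolynomial.ne_zero hq0, totalDegree_X,
    W.isHomogeneous_projectivePolynomial.totalDegree W.irreducible_projectivePolynomial.ne_zero] at hd
  omega

/-- The plane projective curve `Y²Z + a₁XYZ + a₃YZ² = X³ + a₂X²Z + a₄XZ² + a₆Z³` over `k`, as a
scheme. It is an elliptic curve over `k` when the discriminant of `W` is nonzero. -/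
noncomputable def projectiveCurve : Scheme.{u} := Proj W.homogeneousPart

/-- The structure morphism of the curve. -/
noncomputable def projectiveCurveToSpec : W.projectiveCurve ⟶ Spec (.of k) :=
  projToSpec k W.homogeneousPart

instance : IrreducibleSpace W.projectiveCurve :=
  irreducibleSpace_proj k W.homogeneousPart one_pos ⟨X 2, isHomogeneous_X _ _, rfl⟩ W.mk_Z_ne_zero

/-- The product over `k` of the curve and the projective line. -/
noncomputable def prodProjectiveLine : Scheme.{u} :=
  Limits.pullback W.projectiveCurveToSpec (projectiveLineToSpec k)

/-- The structure morphism of the product. -/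
noncomputable def prodProjectiveLineToSpec : W.prodProjectiveLine ⟶ Spec (.of k) :=
  Limits.pullback.fst W.projectiveCurveToSpec (projectiveLineToSpec k) ≫ W.projectiveCurveToSpec

instance : IrreducibleSpace W.prodProjectiveLine :=
  irreducibleSpace_prod_projectiveLine k W.projectiveCurveToSpec

end WeierstrassCurve

/-!
The idea is that `Bir(E × ℙ¹)` contains Heisenberg groups over `ℤ / n` for arbitrarily large `n`.
Such a group is generated by `a` and `b` of order `n` whose commutator `z` is central of order `n`,
and its abelian subgroups have index tending to infinity with `n`
(`not_isJordanGroup_of_heisenberg`).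

Let `K` be the function field of `E`. The points of order dividing `n` act on `K` by translations,
and for `n` a power of two they contain a group `ℤ / n × ℤ / n`, generated by `σ` and `τ`, say
(`WeierstrassCurve.Affine.exists_injective_zmod_two_pow`,
`WeierstrassCurve.Affine.exists_injective_translation`). Let `ζ` be a primitive `n`-th root of
unity. Suppose that there is `g` in `K` with `σ g = ζ g` and with `g * τ g * ⋯ * τ ^ (n - 1) g = 1`.
Then the automorphisms of `K(X)` given by `σ` and `X ↦ X`, and by `τ` and `X ↦ g X`, have order
dividing `n`, and their commutator is `X ↦ ζ X`, which is central in the group which they generate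
(`not_isJordanGroup_algEquiv`).

The element `g` replaces the section of a line bundle with theta group the Heisenberg group. Its
existence is a consequence of Tsen's theorem. If `F` is the fixed field of the group generated by
`σ` and `τ`, then the eigenspace of `σ` for `ζ` has dimension `n` over `F`, and `y ↦ ∏ i, τ ^ i y`
is a form of degree `n` on this space with values in `F`. Hence `∏ i, τ ^ i y = w ^ n` has a
nontrivial solution with `w` in `F`, and `g = y / w` has norm one
(`exists_apply_eq_mul_and_prod_eq_one`). Tsen's theorem is reduced, as usual, to the existence of nontrivial zeros of systems of forms over `k` in more
variables than equations, which comes from the Nullstellensatz and Krull's height theorem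
(`MvPolynomial.exists_ne_zero_aeval_eq_zero`).

Finally, `K(X)` is the function field of `E × ℙ¹`, and the automorphisms of the function field over
`k` act faithfully on the scheme by birational automorphisms (`exists_injective_bir`). Here the
function field is seen as the fraction field of the coordinate ring `A[X]` of a chart, where `A` is
the affine coordinate ring of the curve
(`WeierstrassCurve.exists_isOpenImmersion_prodProjectiveLine`).
-/

/-! ### Heisenberg groups and the Jordan property -/

theorem IsJordanGroup.of_injective {G H : Type*} [Group G] [Group H] (f : G →* H)
    (hf : Function.Injective f) (hH : IsJordanGroup H) : IsJordanGroup G := by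
  obtain ⟨J, hJ, h⟩ := hH
  refine ⟨J, hJ, fun S hS => ?_⟩
  let e : S ≃* S.map f := S.equivMapOfInjective f hf
  obtain ⟨A, hA, hi⟩ := h (S.map f) (Finite.of_equiv S e.toEquiv)
  refine ⟨A.comap e.toMonoidHom, fun x hx y hy => e.injective ?_, ?_⟩
  · rw [map_mul, map_mul]
    exact hA _ hx _ hy
  · rwa [Subgroup.index_comap_of_surjective A e.surjective]

/-- The relations `a * b = z * (b * a)` with `z` central define the Heisenberg group. -/
theorem zpow_mul_zpow_of_commutator {G : Type*} [Group G] {a b z : G} (ha : Commute z a)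
    (hb : Commute z b) (h : a * b = z * (b * a)) (i j : ℤ) :
    a ^ i * b ^ j = z ^ (i * j) * (b ^ j * a ^ i) := by
  have h1 : SemiconjBy a b (z * b) := by
    rw [SemiconjBy, h, mul_assoc]
  have h2 : SemiconjBy (b ^ j) (z ^ j * a) a := by
    have h2 := h1.zpow_right j
    rw [SemiconjBy, hb.mul_zpow] at h2
    rw [SemiconjBy, h2, ← mul_assoc, ((hb.zpow_left j).zpow_right j).eq.symm]
  have h3 := h2.zpow_right i
  rw [SemiconjBy, (ha.zpow_left j).mul_zpow, ← zpow_mul] at h3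
  rw [← h3, ← mul_assoc, ← mul_assoc, mul_comm i j,
    ((hb.zpow_left (j * i)).zpow_right j).eq]

/-- The elements `z ^ i * b ^ j * a ^ l` of a group in which `a * b = z * (b * a)` and `z` commutes
with `a` and `b` form a subgroup. -/
def heisenbergSubgroup {G : Type*} [Group G] {a b z : G} (ha : Commute z a)
    (hb : Commute z b) (h : a * b = z * (b * a)) : Subgroup G where
  carrier := {x | ∃ i j l : ℤ, x = z ^ i * (b ^ j * a ^ l)}
  one_mem' := ⟨0, 0, 0, by simp⟩
  mul_mem' := by
    rintro _ _ ⟨i, j, l, rfl⟩ ⟨i', j', l', rfl⟩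
    refine ⟨i + i' + l * j', j + j', l + l', ?_⟩
    have h1 := zpow_mul_zpow_of_commutator ha hb h l j'
    have h2 : Commute (z ^ i') (b ^ j * a ^ l) :=
      ((hb.zpow_right j).mul_right (ha.zpow_right l)).zpow_left i'
    have h3 : Commute (z ^ (l * j')) (b ^ j) := (hb.zpow_right j).zpow_left _
    calc z ^ i * (b ^ j * a ^ l) * (z ^ i' * (b ^ j' * a ^ l'))
        = z ^ i * ((b ^ j * a ^ l) * z ^ i') * (b ^ j' * a ^ l') := by group
      _ = z ^ i * z ^ i' * b ^ j * (a ^ l * b ^ j') * a ^ l' := by rw [← h2.eq]; group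
      _ = z ^ i * z ^ i' * (b ^ j * z ^ (l * j')) * (b ^ j' * a ^ l * a ^ l') := by
          rw [h1]; group
      _ = _ := by rw [← h3.eq, zpow_add, zpow_add, zpow_add, zpow_add]; group
  inv_mem' := by
    rintro _ ⟨i, j, l, rfl⟩
    refine ⟨l * j - i, -j, -l, ?_⟩
    have h1 := zpow_mul_zpow_of_commutator ha hb h (-l) (-j)
    have h2 : Commute (z ^ (-i)) (b ^ (-j) * a ^ (-l)) :=
      ((hb.zpow_right _).mul_right (ha.zpow_right _)).zpow_left _
    rw [neg_mul_neg] at h1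
    rw [mul_inv_rev, mul_inv_rev, ← zpow_neg, ← zpow_neg, ← zpow_neg, h1, mul_assoc, ← h2.eq,
      sub_eq_add_neg, zpow_add, mul_assoc]

/-- A group containing Heisenberg groups over `ℤ / n` for arbitrarily large `n` is not Jordan: an
abelian subgroup of index at most `J` contains some `a ^ i` and `b ^ j` with `0 < i, j ≤ J`, so
that `z ^ (i * j) = 1` and `n ≤ J ^ 2`. -/
theorem not_isJordanGroup_of_heisenberg {G : Type*} [Group G]
    (hG : ∀ N : ℕ, ∃ n > N, ∃ a b z : G, Commute z a ∧ Commute z b ∧ a * b = z * (b * a) ∧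
      a ^ n = 1 ∧ b ^ n = 1 ∧ orderOf z = n) : ¬ IsJordanGroup G := by
  rintro ⟨J, hJ, hG'⟩
  obtain ⟨n, hn, a, b, z, ha, hb, h, han, hbn, hz⟩ := hG (J * J)
  let H := heisenbergSubgroup ha hb h
  have hn0 : 0 < n := by omega
  have hfa : IsOfFinOrder a := isOfFinOrder_iff_pow_eq_one.mpr ⟨n, hn0, han⟩
  have hfb : IsOfFinOrder b := isOfFinOrder_iff_pow_eq_one.mpr ⟨n, hn0, hbn⟩
  have hfz : IsOfFinOrder z := orderOf_pos_iff.mp (hz ▸ hn0)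
  have hfin : Finite H := by
    have : Finite (Subgroup.zpowers a) := finite_zpowers.mpr hfa
    have : Finite (Subgroup.zpowers b) := finite_zpowers.mpr hfb
    have : Finite (Subgroup.zpowers z) := finite_zpowers.mpr hfz
    have hs : (H : Set G) ⊆ Set.range fun p : Subgroup.zpowers z × Subgroup.zpowers b ×
        Subgroup.zpowers a => (p.1 : G) * (p.2.1 * p.2.2) := by
      rintro _ ⟨i, j, l, rfl⟩
      exact ⟨⟨⟨_, i, rfl⟩, ⟨_, j, rfl⟩, ⟨_, l, rfl⟩⟩, rfl⟩
    exact Set.Finite.subset (Set.finite_range _) hs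
  obtain ⟨A, hA, hi⟩ := hG' H hfin
  have hA0 : A.index ≠ 0 := Subgroup.index_ne_zero_of_finite
  obtain ⟨i, hi0, hiJ, hia⟩ := Subgroup.exists_pow_mem_of_index_ne_zero hA0
    (⟨a, 0, 0, 1, by simp⟩ : H)
  obtain ⟨j, hj0, hjJ, hjb⟩ := Subgroup.exists_pow_mem_of_index_ne_zero hA0
    (⟨b, 0, 1, 0, by simp⟩ : H)
  have hc : a ^ i * b ^ j = b ^ j * a ^ i := congrArg Subtype.val (hA _ hia _ hjb)
  have hc' := zpow_mul_zpow_of_commutator ha hb h i j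
  simp only [zpow_natCast, hc, right_eq_mul] at hc'
  have hz1 : z ^ (i * j) = 1 := by exact_mod_cast hc'
  have := Nat.le_of_dvd (Nat.mul_pos hi0 hj0) (orderOf_dvd_of_pow_eq_one hz1)
  have := Nat.mul_le_mul (hiJ.trans hi) (hjJ.trans hi)
  omega

/-! ### Tsen's theorem -/

/-- The ideal of the origin of affine `s`-space has height at least `s`, by the chain of the ideals
of the linear subspaces where the first `i` coordinates vanish. -/
theorem MvPolynomial.natCast_le_height_ker_aeval_zero (k : Type*) [Field k] (s : ℕ) :
    (s : ℕ∞) ≤ (RingHom.ker (aeval (0 : Fin s → k) :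
      MvPolynomial (Fin s) k →ₐ[k] k)).height := by
  let f (i : ℕ) : MvPolynomial (Fin s) k →ₐ[k] MvPolynomial (Fin s) k :=
    aeval fun j => if j.val < i then 0 else X j
  have hp (i : ℕ) : (RingHom.ker (f i)).IsPrime := RingHom.ker_isPrime _
  have hff (i : ℕ) : (f (i + 1)).comp (f i) = f (i + 1) := by
    ext j : 1
    simp only [f, AlgHom.comp_apply, aeval_X]
    split_ifs with h1 h2 h3
    · simp
    · omega
    · rw [aeval_X, if_pos h3]
    · rw [aeval_X, if_neg h3]
  have hlt (i : ℕ) (hi : i < s) : RingHom.ker (f i) < RingHom.ker (f (i + 1)) := by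
    refine lt_of_le_of_ne (fun p hp => ?_) fun he => ?_
    · rw [RingHom.mem_ker] at hp ⊢
      rw [← hff, AlgHom.comp_apply, hp, map_zero]
    · have : (X ⟨i, hi⟩ : MvPolynomial (Fin s) k) ∈ RingHom.ker (f i) := by
        rw [he, RingHom.mem_ker]
        simp [f]
      rw [RingHom.mem_ker] at this
      simp [f] at this
  have hle (i : ℕ) (hi : i ≤ s) : (i : ℕ∞) ≤ (RingHom.ker (f i)).height := by
    induction i with
    | zero => simp
    | succ i ih =>
      push_cast
      exact (add_le_add_left (ih (by omega)) 1).trans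
        (Ideal.height_add_one_le_of_lt_of_isPrime (hlt i hi))
  refine (hle s le_rfl).trans (Ideal.height_mono fun p hp => ?_)
  rw [RingHom.mem_ker] at hp ⊢
  have h : (aeval (0 : Fin s → k) : MvPolynomial (Fin s) k →ₐ[k] k).comp (f s) = aeval 0 := by
    ext j : 1
    simp [f]
  rw [← h, AlgHom.comp_apply, hp, map_zero]

/-- Fewer polynomials without constant term than variables, over an algebraically closed field, have
a nontrivial common zero: otherwise the ideal which they generate has the origin as its only zero,
which contradicts Krull's height theorem. -/
theorem MvPolynomial.exists_ne_zero_aeval_eq_zero {k : Type*} [Field k] [IsAlgClosed k] {r s : ℕ}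
    (hrs : r < s) (f : Fin r → MvPolynomial (Fin s) k) (hf : ∀ j, aeval (0 : Fin s → k) (f j) = 0) :
    ∃ x : Fin s → k, x ≠ 0 ∧ ∀ j, aeval x (f j) = 0 := by
  by_contra! h
  let I := Ideal.span (Set.range f)
  have hz : zeroLocus k I = {0} := by
    rw [zeroLocus_span]
    ext x
    simp only [Set.mem_range, forall_exists_index, forall_apply_eq_imp_iff, Set.mem_ofPred_eq,
      Set.mem_singleton_iff]
    refine ⟨fun hx => ?_, fun hx => hx ▸ hf⟩
    by_contra hx0
    obtain ⟨j, hj⟩ := h x hx0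
    exact hj (hx j)
  have hI : I.radical = RingHom.ker (aeval (0 : Fin s → k)) := by
    rw [← vanishingIdeal_zeroLocus_eq_radical (K := k), hz]
    ext p
    rw [mem_vanishingIdeal_singleton_iff, RingHom.mem_ker]
  have hpr : (RingHom.ker (aeval (0 : Fin s → k) : MvPolynomial (Fin s) k →ₐ[k] k)).IsPrime :=
    RingHom.ker_isPrime _
  have hI' : I ≠ ⊤ := fun hI' => hpr.ne_top (by rw [← hI, hI', Ideal.radical_top])
  have h1 := natCast_le_height_ker_aeval_zero k s
  rw [← hI] at h1
  have h2 : I.radical.height ≤ I.spanFinrank := by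
    refine le_trans ?_ (Ideal.height_le_spanFinrank I hI')
    rw [I.height_eq_inf_minimalPrimes]
    refine le_iInf₂ fun p hp => ?_
    exact Ideal.height_mono (hp.1.1.radical_le_iff.mpr hp.1.2)
  have h3 : I.spanFinrank ≤ r := by
    refine (Submodule.spanFinrank_span_le_ncard_of_finite (Set.finite_range f)).trans ?_
    rw [← Nat.card_coe_set_eq]
    exact_mod_cast (Finite.card_range_le f).trans_eq (Nat.card_fin r)
  have h4 := h1.trans (h2.trans (Nat.cast_le.mpr h3))
  exact absurd (Nat.cast_le.mp h4) (by omega)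

/-- Over an algebraically closed field, a system of forms of the same degree in more variables than
equations has a nontrivial zero. The forms are the diagonal values of a multilinear map, whose
target has the number of equations as its dimension. -/
theorem MultilinearMap.exists_ne_zero_map_diagonal_eq_zero {k V U : Type*} [Field k] [IsAlgClosed k]
    [AddCommGroup V] [Module k V] [FiniteDimensional k V] [AddCommGroup U] [Module k U]
    [FiniteDimensional k U] {n : ℕ} (hn : n ≠ 0) (T : MultilinearMap k (fun _ : Fin n => V) U)
    (h : Module.finrank k U < Module.finrank k V) : ∃ v ≠ 0, T (fun _ => v) = 0 := by
  let b := Module.finBasis k V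
  let c := Module.finBasis k U
  let f (j) : MvPolynomial (Fin (Module.finrank k V)) k :=
    ∑ I : Fin n → Fin (Module.finrank k V),
      (∏ l, MvPolynomial.X (I l)) * MvPolynomial.C (c.repr (T fun l => b (I l)) j)
  have hf (x j) : MvPolynomial.aeval x (f j) = c.repr (T fun _ => ∑ i, x i • b i) j := by
    rw [T.map_sum]
    simp [f, T.map_smul_univ, Finsupp.finsetSum_apply]
  obtain ⟨x, hx0, hx⟩ := MvPolynomial.exists_ne_zero_aeval_eq_zero h f fun j => by
    rw [hf]
    have : NeZero n := ⟨hn⟩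
    simp [T.map_coord_zero (0 : Fin n)]
  refine ⟨∑ i, x i • b i, fun h0 => hx0 ?_, ?_⟩
  · funext i
    exact Fintype.linearIndependent_iff.mp b.linearIndependent x h0 i
  · apply c.repr.injective
    ext j
    rw [← hf, hx]
    simp

open Polynomial in
/-- **Tsen's theorem**, for systems of forms of the same degree over `k(X)`, with `k` algebraically
closed: `T` has a nontrivial zero on the diagonal as soon as the number `finrank Q V` of variables
exceeds the degree `n` times the number `finrank Q U` of equations. On vectors with polynomial
coordinates of degree less than `m`, the number of coefficients of the variables grows as
`m * finrank Q V`, and that of the coefficients of the equations as `n * m * finrank Q U`. -/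
theorem MultilinearMap.exists_ne_zero_map_diagonal_eq_zero_of_isFractionRing {k Q V U : Type*}
    [Field k] [IsAlgClosed k] [Field Q] [Algebra k[X] Q] [IsFractionRing k[X] Q]
    [AddCommGroup V] [Module Q V] [FiniteDimensional Q V] [AddCommGroup U] [Module Q U]
    [FiniteDimensional Q U] {n : ℕ} (hn : n ≠ 0) (T : MultilinearMap Q (fun _ : Fin n => V) U)
    (h : n * Module.finrank Q U < Module.finrank Q V) : ∃ v ≠ 0, T (fun _ => v) = 0 := by
  let _ : Algebra k Q := ((algebraMap k[X] Q).comp C).toAlgebra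
  have : IsScalarTower k k[X] Q := .of_algebraMap_eq' rfl
  let _ : Module k V := Module.compHom V (algebraMap k Q)
  let _ : Module k U := Module.compHom U (algebraMap k Q)
  have : IsScalarTower k Q V := ⟨fun a q v => by
    rw [Algebra.smul_def, mul_smul]; rfl⟩
  have : IsScalarTower k Q U := ⟨fun a q v => by
    rw [Algebra.smul_def, mul_smul]; rfl⟩
  let s := Module.finrank Q V
  let r := Module.finrank Q U
  let b : Module.Basis (Fin s) Q V := Module.finBasis Q V
  let c : Module.Basis (Fin r) Q U := Module.finBasis Q U
  obtain ⟨D, hD⟩ := IsLocalization.exist_integer_multiples_of_finite (nonZeroDivisors k[X])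
    fun x : (Fin n → Fin s) × Fin r => c.repr (T fun l => b (x.1 l)) x.2
  choose p hp using hD
  obtain ⟨e, he⟩ := (Set.finite_range fun x => (p x).natDegree).bddAbove
  have he (x) : (p x).natDegree < e + 1 := Nat.lt_succ_of_le (he ⟨x, rfl⟩)
  -- chosen such that `r * N < s * m`, where `n * r < s`
  let m := r * (e + 1) + 1
  let N := n * m + (e + 1)
  let φ : (Fin s → degreeLT k m) →ₗ[k] V :=
    { toFun q := ∑ i, algebraMap k[X] Q (q i) • b i
      map_add' q q' := by simp [add_smul, Finset.sum_add_distrib]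
      map_smul' a q := by
        simp only [Pi.smul_apply, SetLike.val_smul, algebraMap.coe_smul, Finset.smul_sum,
          RingHom.id_apply, smul_assoc] }
  let ψ : (Fin r → degreeLT k N) →ₗ[k] U :=
    { toFun q := ∑ i, algebraMap k[X] Q (q i) • c i
      map_add' q q' := by simp [add_smul, Finset.sum_add_distrib]
      map_smul' a q := by
        simp only [Pi.smul_apply, SetLike.val_smul, algebraMap.coe_smul, Finset.smul_sum,
          RingHom.id_apply, smul_assoc] }
  have hφ : Function.Injective φ := by
    rw [injective_iff_map_eq_zero]
    intro q hq
    funext i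
    have := Fintype.linearIndependent_iff.mp b.linearIndependent _ hq i
    exact Subtype.ext ((map_eq_zero_iff _ (IsFractionRing.injective k[X] Q)).mp this)
  let d : Q := algebraMap k[X] Q D
  have hd : d ≠ 0 := IsFractionRing.to_map_ne_zero_of_mem_nonZeroDivisors D.2
  let T' : MultilinearMap k (fun _ : Fin n => Fin s → degreeLT k m) U :=
    ((d • T).restrictScalars k).compLinearMap fun _ => φ
  have hT' (q) : T' q ∈ LinearMap.range ψ := by
    refine ⟨fun j => ⟨∑ I : Fin n → Fin s, (∏ l, (q l (I l) : k[X])) * p (I, j),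
      Submodule.sum_mem _ fun I _ => ?_⟩, ?_⟩
    · rw [mem_degreeLT]
      refine degree_le_natDegree.trans_lt (Nat.cast_lt.mpr ?_)
      have h1 : (∏ l, (q l (I l) : k[X])).natDegree ≤ n * m := by
        refine (natDegree_prod_le _ _).trans
          ((Finset.sum_le_card_nsmul _ _ m fun l _ => ?_).trans ?_)
        · exact natDegree_le_iff_degree_le.mpr (mem_degreeLT.mp (q l (I l)).2).le
        · simp
      exact natDegree_mul_le.trans_lt (by have := he (I, j); omega)
    · have h1 (I : Fin n → Fin s) : d • T (fun l => b (I l)) =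
          ∑ j, algebraMap k[X] Q (p (I, j)) • c j := by
        rw [← c.sum_repr (T fun l => b (I l)), Finset.smul_sum]
        refine Finset.sum_congr rfl fun j _ => ?_
        rw [hp, smul_smul, Algebra.smul_def]
      change ∑ j, algebraMap k[X] Q
          (∑ I : Fin n → Fin s, (∏ l, (q l (I l) : k[X])) * p (I, j)) • c j =
        d • T (fun l => ∑ i, algebraMap k[X] Q (q l i) • b i)
      simp only [T.map_sum, T.map_smul_univ, Finset.smul_sum, smul_comm d, h1, _root_.map_sum,
        Finset.sum_smul, map_mul, map_prod, mul_smul]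
      exact Finset.sum_comm
  have : Module.Finite k (degreeLT k N) := .equiv (degreeLTEquiv k N).symm
  have : Module.Finite k (degreeLT k m) := .equiv (degreeLTEquiv k m).symm
  have hN : Module.finrank k (degreeLT k N) = N := by
    simp [(degreeLTEquiv k N).finrank_eq]
  have hm : Module.finrank k (degreeLT k m) = m := by
    simp [(degreeLTEquiv k m).finrank_eq]
  obtain ⟨q, hq0, hq⟩ :=
    (T'.codRestrict (LinearMap.range ψ) hT').exists_ne_zero_map_diagonal_eq_zero hn (by
      refine (LinearMap.finrank_range_le ψ).trans_lt ?_
      rw [Module.finrank_pi_fintype, Module.finrank_pi_fintype]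
      simp only [hN, hm, Finset.sum_const, Finset.card_univ, Fintype.card_fin, smul_eq_mul]
      calc r * N = n * r * m + r * (e + 1) := by ring
        _ < (n * r + 1) * m := by
          rw [add_mul, one_mul]
          exact Nat.add_lt_add_left (Nat.lt_succ_self _) _
        _ ≤ s * m := Nat.mul_le_mul_right _ h)
  refine ⟨φ q, fun h0 => hq0 (hφ (h0.trans (_root_.map_zero φ).symm)), ?_⟩
  exact (smul_eq_zero.mp (congrArg Subtype.val hq : d • T (fun _ => φ q) = 0)).resolve_left hd

/-! ### Eigenvectors of norm one -/

/-- A cyclic group of order `n` of field automorphisms has an eigenvector for each `n`-th root of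
unity `ζ`: the projection `∑ i, ζ⁻ⁱ σⁱ` onto the eigenspace is nonzero by the linear independence of
characters. -/
theorem AlgEquiv.exists_apply_eq_mul_of_pow_eq_one {Q K : Type*} [Field Q] [Field K] [Algebra Q K]
    (σ : K ≃ₐ[Q] K) {n : ℕ} (hn : n ≠ 0) (hσ : orderOf σ = n) {ζ : Q} (hζ : ζ ^ n = 1) :
    ∃ g ≠ 0, σ g = algebraMap Q K ζ * g := by
  let z := algebraMap Q K ζ
  have hz : z ^ n = 1 := by rw [← map_pow, hζ, map_one]
  have hz0 : z ≠ 0 := by rintro h0; rw [h0, zero_pow hn] at hz; exact zero_ne_one hz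
  let χ (i : Fin n) : K →* K := ((σ ^ (i : ℕ) : K ≃ₐ[Q] K) : K →* K)
  have hχ : Function.Injective χ := fun i j h => by
    have h : σ ^ (i : ℕ) = σ ^ (j : ℕ) := AlgEquiv.ext fun x => DFunLike.congr_fun h x
    exact Fin.ext (pow_injOn_Iio_orderOf (by simp [hσ]) (by simp [hσ]) h)
  have hli := (linearIndependent_monoidHom K K).comp χ hχ
  rw [Fintype.linearIndependent_iff] at hli
  have hne : ∃ c, ∑ i ∈ Finset.range n, z⁻¹ ^ i * (σ ^ i) c ≠ 0 := by
    by_contra! h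
    have := hli (fun i => z⁻¹ ^ (i : ℕ)) (by
      funext c
      rw [Finset.sum_apply, Pi.zero_apply, ← h c, Finset.sum_range]
      rfl) ⟨0, Nat.pos_of_ne_zero hn⟩
    simp at this
  obtain ⟨c, hc⟩ := hne
  refine ⟨_, hc, ?_⟩
  have hσz (i : ℕ) : σ (z⁻¹ ^ i) = z⁻¹ ^ i := by
    rw [map_pow, map_inv₀, AlgEquiv.commutes]
  have h1 : ∑ i ∈ Finset.range n, z⁻¹ ^ (i + 1) * (σ ^ (i + 1)) c =
      ∑ i ∈ Finset.range n, z⁻¹ ^ i * (σ ^ i) c := by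
    have h2 := Finset.sum_range_succ' (fun i => z⁻¹ ^ i * (σ ^ i) c) n
    rw [Finset.sum_range_succ] at h2
    have h3 : σ ^ n = 1 := hσ ▸ pow_orderOf_eq_one σ
    rw [h3, inv_pow, hz] at h2
    simpa using h2.symm
  nth_rw 2 [← h1]
  rw [map_sum, Finset.mul_sum]
  refine Finset.sum_congr rfl fun i _ => ?_
  rw [map_mul, hσz, pow_succ' σ, AlgEquiv.mul_apply, pow_succ' z⁻¹, ← mul_assoc, ← mul_assoc]
  change _ = z * z⁻¹ * _ * _
  rw [mul_inv_cancel₀ hz0, one_mul]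

/-- For an action of `ℤ / n × ℤ / n` on a finite extension `K` of `Q = k(X)`, the eigenspace of the
first generator `σ` for the eigenvalue `ζ` contains an element of norm one for the second generator
`τ`. Indeed, if `F` is the fixed field, the norm is a form of degree `n` over `F` on the eigenspace,
which has dimension `n` over `F`, and the form `N(z) - w ^ n` in `n + 1` variables has a nontrivial
zero by Tsen's theorem. -/
theorem exists_apply_eq_mul_and_prod_eq_one {k Q K : Type*}
    [Field k] [IsAlgClosed k] [Field Q] [Algebra (Polynomial k) Q] [IsFractionRing (Polynomial k) Q]
    [Field K] [Algebra Q K] [FiniteDimensional Q K] {n : ℕ} [NeZero n]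
    (ρ : Multiplicative (ZMod n × ZMod n) →* (K ≃ₐ[Q] K)) (hρ : Function.Injective ρ)
    {ζ : Q} (hζ : ζ ^ n = 1) :
    ∃ g ≠ 0, ρ (.ofAdd (1, 0)) g = algebraMap Q K ζ * g ∧
      ∏ i ∈ Finset.range n, (ρ (.ofAdd (0, 1)) ^ i) g = 1 := by
  have hn : n ≠ 0 := NeZero.ne n
  set σ := ρ (.ofAdd (1, 0)) with hσ
  set τ := ρ (.ofAdd (0, 1)) with hτ
  have hσn : orderOf σ = n := by
    rw [hσ, orderOf_injective ρ hρ, orderOf_ofAdd_eq_addOrderOf, Prod.addOrderOf_mk]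
    simp
  have hτn : τ ^ n = 1 := by
    rw [hτ, ← map_pow ρ, ← ofAdd_nsmul, Prod.smul_mk, smul_zero, nsmul_one, ZMod.natCast_self]
    exact map_one ρ
  have hcomm : Commute σ τ := by
    rw [Commute, SemiconjBy, hσ, hτ, ← map_mul ρ, ← map_mul ρ, mul_comm]
  have hgen (x) : ρ x = σ ^ (x.toAdd.1.val) * τ ^ (x.toAdd.2.val) := by
    rw [hσ, hτ, ← map_pow ρ, ← map_pow ρ, ← map_mul ρ]
    congr 1
    apply Multiplicative.toAdd.injective
    ext <;> simp
  obtain ⟨g₀, hg₀, hσg₀⟩ := σ.exists_apply_eq_mul_of_pow_eq_one hn hσn hζ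
  let E := IntermediateField.fixedField (Subgroup.zpowers σ)
  let F := IntermediateField.fixedField ρ.range
  have hE : Module.finrank E K = n := by
    rw [IntermediateField.finrank_fixedField_eq_card, Nat.card_zpowers, hσn]
  have hF : Module.finrank F K = n * n := by
    rw [IntermediateField.finrank_fixedField_eq_card,
      ← Nat.card_congr (MonoidHom.ofInjective hρ).toEquiv,
      Nat.card_congr (Multiplicative.toAdd (α := ZMod n × ZMod n)), Nat.card_prod, Nat.card_zmod]
  have hEF : Module.finrank Q E = n * Module.finrank Q F := by
    have h1 := Module.finrank_mul_finrank Q E K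
    have h2 := Module.finrank_mul_finrank Q F K
    rw [hE] at h1
    rw [hF, ← h1, mul_comm n n, ← mul_assoc] at h2
    have := mul_right_cancel₀ hn h2
    rw [← this, mul_comm]
  have hσE (x : E) : σ x = x := x.2 ⟨σ, Subgroup.mem_zpowers σ⟩
  have hσF (x : F) : σ x = x := x.2 ⟨σ, _, rfl⟩
  have hτF (i : ℕ) (x : F) : (τ ^ i) x = x := x.2 ⟨τ ^ i, _, map_pow ρ _ i⟩
  have hmemF (x : K) (h1 : σ x = x) (h2 : τ x = x) : x ∈ F := by
    rintro ⟨_, y, rfl⟩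
    have h1 (i : ℕ) : (σ ^ i) x = x := by
      induction i with
      | zero => rfl
      | succ i ih => rw [pow_succ, AlgEquiv.mul_apply, h1, ih]
    have h2 (i : ℕ) : (τ ^ i) x = x := by
      induction i with
      | zero => rfl
      | succ i ih => rw [pow_succ, AlgEquiv.mul_apply, h2, ih]
    change ρ y x = x
    rw [hgen, AlgEquiv.mul_apply, h2, h1]
  -- the norm of an element of the eigenspace of `σ` is in `F`
  have hN (z : E) : ∏ i : Fin n, (τ ^ (i : ℕ)) (g₀ * z) ∈ F := by
    have h1 : σ (g₀ * z) = algebraMap Q K ζ * (g₀ * z) := by rw [map_mul, hσg₀, hσE, mul_assoc]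
    apply hmemF
    · have h2 (i : ℕ) : σ ((τ ^ i) (g₀ * z)) = algebraMap Q K ζ * (τ ^ i) (g₀ * z) := by
        rw [← AlgEquiv.mul_apply, (hcomm.pow_right i).eq, AlgEquiv.mul_apply, h1, map_mul,
          AlgEquiv.commutes]
      simp only [map_prod, h2, Finset.prod_mul_distrib, Finset.prod_const, Finset.card_univ,
        Fintype.card_fin, ← map_pow, hζ, map_one, one_mul]
    · rw [← Finset.prod_range (fun i => (τ ^ i) (g₀ * z)), map_prod]
      have h2 := Finset.prod_range_succ' (fun i => (τ ^ i) (g₀ * z)) n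
      rw [Finset.prod_range_succ, hτn] at h2
      have h3 : g₀ * (z : K) ≠ 0 ∨ g₀ * (z : K) = 0 := ne_or_eq _ _
      rcases h3 with h3 | h3
      · have := mul_right_cancel₀ h3 h2
        simp only [← AlgEquiv.mul_apply, ← pow_succ'] at this ⊢
        exact this.symm
      · simp [h3]
  obtain ⟨π, hπ⟩ := LinearMap.exists_leftInverse_of_injective F.val.toLinearMap
    (LinearMap.ker_eq_bot.mpr F.val.injective)
  have hπ (x : F) : π x = x := LinearMap.congr_fun hπ x
  let M₁ : MultilinearMap Q (fun _ : Fin n => E × F) K :=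
    (MultilinearMap.mkPiAlgebra Q (Fin n) K).compLinearMap fun i =>
      (τ ^ (i : ℕ)).toLinearMap ∘ₗ LinearMap.mulLeft Q g₀ ∘ₗ E.val.toLinearMap ∘ₗ
        LinearMap.fst Q E F
  let M₂ : MultilinearMap Q (fun _ : Fin n => E × F) K :=
    (MultilinearMap.mkPiAlgebra Q (Fin n) K).compLinearMap fun i =>
      F.val.toLinearMap ∘ₗ LinearMap.snd Q E F
  obtain ⟨⟨z, w⟩, hzw0, hzw⟩ :=
    (π.compMultilinearMap (M₁ - M₂)).exists_ne_zero_map_diagonal_eq_zero_of_isFractionRing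
      (k := k) hn (by
        rw [Module.finrank_prod, hEF]
        exact Nat.lt_add_of_pos_right Module.finrank_pos)
  have h1 : π (∏ i : Fin n, (τ ^ (i : ℕ)) (g₀ * z)) - π ((w : K) ^ n) = 0 := by
    rw [← map_sub, ← hzw]
    simp [M₁, M₂]
  rw [show ∏ i : Fin n, (τ ^ (i : ℕ)) (g₀ * z) = ((⟨_, hN z⟩ : F) : K) from rfl, hπ,
    show (w : K) ^ n = ((w ^ n : F) : K) from rfl, hπ, sub_eq_zero, Subtype.ext_iff] at h1
  change ∏ i : Fin n, (τ ^ (i : ℕ)) (g₀ * z) = (w : K) ^ n at h1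
  have hw : w ≠ 0 := by
    rintro rfl
    rw [ZeroMemClass.coe_zero, zero_pow hn, Finset.prod_eq_zero_iff] at h1
    obtain ⟨i, -, hi⟩ := h1
    rw [EmbeddingLike.map_eq_zero_iff, mul_eq_zero, or_iff_right hg₀] at hi
    exact hzw0 (Prod.ext (Subtype.ext hi) rfl)
  have hw' : (w : K) ≠ 0 := fun h => hw (Subtype.ext h)
  have hgw (i : ℕ) : (τ ^ i) (g₀ * z / w) = (τ ^ i) (g₀ * z) / w := by
    rw [map_div₀, hτF]
  have hN1 : ∏ i ∈ Finset.range n, (τ ^ i) (g₀ * z / w) = 1 := by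
    rw [Finset.prod_range]
    simp only [hgw, Finset.prod_div_distrib, h1, Finset.prod_const, Finset.card_univ,
      Fintype.card_fin]
    exact div_self (pow_ne_zero _ hw')
  refine ⟨g₀ * z / w, fun h0 => ?_, ?_, hN1⟩
  · simp [h0, hn] at hN1
  · rw [map_div₀, map_mul, hσg₀, hσE, hσF]
    ring

/-! ### Torsion points of order a power of two -/

namespace WeierstrassCurve.Affine

open Polynomial in
/-- The points of an elliptic curve are divisible by two: among the lines through `-P` there is one
which is tangent to the curve at another point `R`, as the slopes of these lines are the roots of a
quartic polynomial, and then `R + R = P`. -/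
theorem exists_add_self_eq {k : Type*} [Field k] [IsAlgClosed k] [DecidableEq k]
    (h2 : (2 : k) ≠ 0) (W : WeierstrassCurve.Affine k) [W.IsElliptic] (P : W.Point) :
    ∃ R : W.Point, R + R = P := by
  rcases P with _ | ⟨a, y₀, h₀⟩
  · exact ⟨0, add_zero 0⟩
  set b := W.negY a y₀ with hb
  have hab : W.Equation a b := (W.equation_neg a y₀).mpr h₀.1
  rw [equation_iff] at hab
  let s := W.a₂ + a
  -- this quartic in `ℓ` is the discriminant of the quadratic polynomial for the first coordinates of
  -- the two other intersections of the curve with the line of slope `ℓ` through `-P = (a, b)`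
  obtain ⟨ℓ, hℓ⟩ := IsAlgClosed.exists_root
    (X ^ 4 + C (2 * W.a₁) * X ^ 3 + C (W.a₁ ^ 2 - 2 * s - 4 * a) * X ^ 2
      + C (-2 * W.a₁ * s + 8 * b + 4 * W.a₃) * X + C (s ^ 2 - 4 * (W.a₄ - W.a₁ * b + a * s)))
    (by
      have : (X ^ 4 + C (2 * W.a₁) * X ^ 3 + C (W.a₁ ^ 2 - 2 * s - 4 * a) * X ^ 2
        + C (-2 * W.a₁ * s + 8 * b + 4 * W.a₃) * X
        + C (s ^ 2 - 4 * (W.a₄ - W.a₁ * b + a * s))).degree = 4 := by compute_degree!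
      rw [this]
      exact four_ne_zero)
  simp only [IsRoot, eval_add, eval_mul, eval_pow, eval_X, eval_C] at hℓ
  obtain ⟨x, h1⟩ : ∃ x, 2 * x = ℓ ^ 2 + W.a₁ * ℓ - s :=
    ⟨(ℓ ^ 2 + W.a₁ * ℓ - s) / 2, mul_div_cancel₀ _ h2⟩
  have h3 : x ^ 2 = a * ℓ ^ 2 - (2 * b + W.a₃) * ℓ + W.a₄ - W.a₁ * b + a * s := by
    refine mul_left_cancel₀ (mul_ne_zero h2 h2) ?_
    linear_combination (2 * x + (ℓ ^ 2 + W.a₁ * ℓ - s)) * h1 + hℓ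
  obtain ⟨y, hy⟩ : ∃ y, y = ℓ * (x - a) + b := ⟨_, rfl⟩
  have hxy : W.Equation x y := by
    rw [equation_iff, hy]
    linear_combination hab - (x - a) * (x * h1 - h3)
  have hd : 3 * x ^ 2 + 2 * W.a₂ * x + W.a₄ - W.a₁ * y = ℓ * (2 * y + W.a₁ * x + W.a₃) := by
    rw [hy]
    linear_combination (x * h1 - h3) + (x - a) * h1
  have hns := W.equation_iff_nonsingular.mp hxy
  have hne : 2 * y + W.a₁ * x + W.a₃ ≠ 0 := by
    intro h0
    rcases ((W.nonsingular_iff' x y).mp hns).2 with h | h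
    · apply h
      linear_combination -hd - ℓ * h0
    · exact h h0
  have hyn : y ≠ W.negY x y := by
    intro h
    apply hne
    rw [negY] at h
    linear_combination h
  have hs : W.slope x x y y = ℓ := by
    rw [slope_of_Y_ne rfl hyn, hd, negY, div_eq_iff (by convert hne using 1; ring)]
    ring
  have hX : W.addX x x ℓ = a := by
    rw [addX]
    linear_combination -h1
  refine ⟨.some x y hns, ?_⟩
  rw [Point.add_self_of_Y_ne hyn, Point.some.injEq, hs]
  refine ⟨hX, ?_⟩
  rw [addY, negAddY, hX, hy, show ℓ * (a - x) + (ℓ * (x - a) + b) = b by ring, hb, negY_negY]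

/-- The points of order two are those with `2 y + a₁ x + a₃ = 0`; their first coordinates are the
three roots of the two-torsion polynomial. -/
theorem exists_two_torsion_ne {k : Type*} [Field k] [IsAlgClosed k] [DecidableEq k]
    (h2 : (2 : k) ≠ 0) (W : WeierstrassCurve.Affine k) [W.IsElliptic] :
    ∃ P Q : W.Point, P ≠ 0 ∧ Q ≠ 0 ∧ P ≠ Q ∧ P + P = 0 ∧ Q + Q = 0 := by
  have h4 : W.twoTorsionPolynomial.a ≠ 0 := by
    rw [twoTorsionPolynomial, show (4 : k) = 2 * 2 by norm_num]
    exact mul_ne_zero h2 h2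
  have hΔ : W.twoTorsionPolynomial.discr ≠ 0 :=
    W.twoTorsionPolynomial_discr_ne_zero (isUnit_iff_ne_zero.mpr h2) W.isUnit_Δ
  have hcard := Cubic.card_roots_of_discr_ne_zero (φ := RingHom.id k) h4
    (IsAlgClosed.splits _) hΔ
  obtain ⟨e₁, he₁, e₂, he₂, hne⟩ := Finset.one_lt_card.mp (hcard.symm ▸ (by norm_num : 1 < 3))
  have key (e : k) (he : e ∈ (Cubic.map (RingHom.id k) W.twoTorsionPolynomial).roots.toFinset) :
      ∃ y, ∃ h : W.Nonsingular e y, Point.some e y h + Point.some e y h = 0 := by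
    rw [Multiset.mem_toFinset, Cubic.map_roots, Polynomial.map_id, Polynomial.mem_roots'] at he
    have he := he.2
    simp only [Polynomial.IsRoot, Cubic.toPoly, twoTorsionPolynomial, Polynomial.eval_add,
      Polynomial.eval_mul, Polynomial.eval_C, Polynomial.eval_X, Polynomial.eval_pow, b₂, b₄,
      b₆] at he
    obtain ⟨y, hy⟩ : ∃ y, 2 * y = -(W.a₁ * e + W.a₃) :=
      ⟨-(W.a₁ * e + W.a₃) / 2, mul_div_cancel₀ _ h2⟩
    have heq : W.Equation e y := by
      rw [equation_iff]
      refine mul_left_cancel₀ (mul_ne_zero h2 h2) ?_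
      linear_combination (2 * y + W.a₁ * e + W.a₃) * hy - he
    refine ⟨y, W.equation_iff_nonsingular.mp heq, Point.add_self_of_Y_eq ?_⟩
    rw [negY]
    linear_combination hy
  obtain ⟨y₁, h₁, hP⟩ := key e₁ he₁
  obtain ⟨y₂, h₂, hQ⟩ := key e₂ he₂
  refine ⟨_, _, Point.some_ne_zero h₁, Point.some_ne_zero h₂, fun h => hne ?_, hP, hQ⟩
  rw [Point.some.injEq] at h
  exact h.1

/-- Division by two from two independent points of order two leads to independent points of order
`2 ^ m`. -/
theorem exists_injective_zmod_two_pow {k : Type*} [Field k] [IsAlgClosed k] [DecidableEq k]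
    (h2 : (2 : k) ≠ 0) (W : WeierstrassCurve.Affine k) [W.IsElliptic] (m : ℕ) :
    ∃ f : ZMod (2 ^ (m + 1)) × ZMod (2 ^ (m + 1)) →+ W.Point, Function.Injective f := by
  obtain ⟨T₁, T₂, h₁, h₂, h₁₂, hT₁, hT₂⟩ := exists_two_torsion_ne h2 W
  have hz1 (a : ℤ) : a • T₁ = if Even a then 0 else T₁ := by
    rcases Int.even_or_odd' a with ⟨c, rfl | rfl⟩
    · rw [if_pos (even_two_mul c), mul_comm, mul_zsmul, two_zsmul, hT₁, smul_zero]
    · rw [if_neg (by simp), add_zsmul, mul_comm, mul_zsmul, two_zsmul, hT₁, smul_zero,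
        zero_add, one_zsmul]
  have hz2 (a : ℤ) : a • T₂ = if Even a then 0 else T₂ := by
    rcases Int.even_or_odd' a with ⟨c, rfl | rfl⟩
    · rw [if_pos (even_two_mul c), mul_comm, mul_zsmul, two_zsmul, hT₂, smul_zero]
    · rw [if_neg (by simp), add_zsmul, mul_comm, mul_zsmul, two_zsmul, hT₂, smul_zero,
        zero_add, one_zsmul]
  have hT (a b : ℤ) (h : a • T₁ + b • T₂ = 0) : Even a ∧ Even b := by
    rw [hz1, hz2] at h
    split_ifs at h with h3 h4 h4
    · exact ⟨h3, h4⟩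
    · exact absurd (by simpa using h) h₂
    · exact absurd (by simpa using h) h₁
    · refine absurd (add_right_cancel (b := T₂) ?_) h₁₂
      rw [h, hT₂]
  have hind : ∃ P Q : W.Point, (2 : ℤ) ^ m • P = T₁ ∧ (2 : ℤ) ^ m • Q = T₂ ∧
      ∀ a b : ℤ, a • P + b • Q = 0 → (2 : ℤ) ^ (m + 1) ∣ a ∧ (2 : ℤ) ^ (m + 1) ∣ b := by
    induction m with
    | zero =>
      refine ⟨T₁, T₂, by simp, by simp, fun a b h => ?_⟩
      simpa [even_iff_two_dvd] using hT a b h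
    | succ m ih =>
      obtain ⟨P, Q, hP, hQ, hPQ⟩ := ih
      obtain ⟨P', rfl⟩ := exists_add_self_eq h2 W P
      obtain ⟨Q', rfl⟩ := exists_add_self_eq h2 W Q
      simp only [← two_zsmul, ← mul_zsmul', ← pow_succ'] at hP hQ
      refine ⟨P', Q', hP, hQ, fun a b h => ?_⟩
      obtain ⟨⟨a, rfl⟩, b, rfl⟩ := hPQ a b (by
        simp only [← two_zsmul, smul_comm _ (2 : ℤ), ← smul_add, h, smul_zero])
      rw [mul_zsmul', mul_zsmul', hP, hQ] at h
      have h3 := hT a b h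
      rw [even_iff_two_dvd, even_iff_two_dvd] at h3
      rw [pow_succ _ (m + 1)]
      exact ⟨mul_dvd_mul_left _ h3.1, mul_dvd_mul_left _ h3.2⟩
  obtain ⟨P, Q, hP, hQ, hPQ⟩ := hind
  have hn (R T : W.Point) (hR : (2 : ℤ) ^ m • R = T) (hT : T + T = 0) :
      zmultiplesHom W.Point R ((2 ^ (m + 1) : ℕ) : ℤ) = 0 := by
    rw [zmultiplesHom_apply, Nat.cast_pow, Nat.cast_ofNat, pow_succ', mul_zsmul, hR, two_zsmul, hT]
  let fP : ZMod (2 ^ (m + 1)) →+ W.Point := ZMod.lift _ ⟨zmultiplesHom _ P, hn P T₁ hP hT₁⟩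
  let fQ : ZMod (2 ^ (m + 1)) →+ W.Point := ZMod.lift _ ⟨zmultiplesHom _ Q, hn Q T₂ hQ hT₂⟩
  refine ⟨fP.coprod fQ, (injective_iff_map_eq_zero _).mpr ?_⟩
  rintro ⟨a, b⟩ h
  obtain ⟨a, rfl⟩ := ZMod.intCast_surjective a
  obtain ⟨b, rfl⟩ := ZMod.intCast_surjective b
  rw [AddMonoidHom.coprod_apply, ZMod.lift_coe, ZMod.lift_coe] at h
  have h3 := hPQ a b h
  refine Prod.ext ?_ ?_
  · exact (ZMod.intCast_zmod_eq_zero_iff_dvd _ _).mpr (by exact_mod_cast h3.1)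
  · exact (ZMod.intCast_zmod_eq_zero_iff_dvd _ _).mpr (by exact_mod_cast h3.2)

end WeierstrassCurve.Affine

/-! ### Translations acting on the function field -/

namespace WeierstrassCurve.Affine

open Polynomial

variable {k : Type*} [Field k] (W : WeierstrassCurve.Affine k)

/-- The coordinate `X`, as an element of the function field. -/
noncomputable def genericX : W.FunctionField :=
  algebraMap W.CoordinateRing W.FunctionField (AdjoinRoot.of _ X)

/-- The coordinate `Y`, as an element of the function field. -/
noncomputable def genericY : W.FunctionField :=
  algebraMap W.CoordinateRing W.FunctionField (AdjoinRoot.root _)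

variable {W} in
theorem eval₂_polynomial {L : Type*} [CommRing L] [Algebra k L] (x y : L) :
    W.polynomial.eval₂ ((aeval x : k[X] →ₐ[k] L) : k[X] →+* L) y = 0 ↔
      (W.baseChange L).toAffine.Equation x y := by
  rw [equation_iff']
  change _ ↔ y ^ 2 + algebraMap k L W.a₁ * x * y + algebraMap k L W.a₃ * y - (x ^ 3 +
    algebraMap k L W.a₂ * x ^ 2 + algebraMap k L W.a₄ * x + algebraMap k L W.a₆) = 0
  simp only [polynomial, eval₂_sub, eval₂_add, eval₂_mul,
    eval₂_pow, eval₂_X, eval₂_C, map_add, map_mul, map_pow, aeval_C, aeval_X, RingHom.coe_coe]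
  rw [add_mul, ← add_assoc]

theorem aeval_genericX (p : k[X]) : aeval W.genericX p =
    algebraMap W.CoordinateRing W.FunctionField (AdjoinRoot.of _ p) := by
  have h : (aeval W.genericX : k[X] →ₐ[k] W.FunctionField) =
      (Algebra.algHom k W.CoordinateRing W.FunctionField).comp
        (Algebra.algHom k k[X] W.CoordinateRing) := by
    ext
    rw [aeval_X]
    rfl
  rw [h]
  rfl

theorem equation_generic :
    (W.baseChange W.FunctionField).toAffine.Equation W.genericX W.genericY := by
  have h : ((aeval W.genericX : k[X] →ₐ[k] W.FunctionField) : k[X] →+* W.FunctionField) =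
      (algebraMap W.CoordinateRing W.FunctionField).comp (AdjoinRoot.of W.polynomial) :=
    RingHom.ext W.aeval_genericX
  rw [← eval₂_polynomial, h, genericY, ← hom_eval₂, AdjoinRoot.eval₂_root, map_zero]

theorem transcendental_genericX : Transcendental k W.genericX := by
  rw [transcendental_iff]
  intro p hp
  rw [aeval_genericX] at hp
  have h1 := (map_eq_zero_iff _ (IsFractionRing.injective W.CoordinateRing W.FunctionField)).mp hp
  exact (map_eq_zero_iff _ (FaithfulSMul.algebraMap_injective k[X] W.CoordinateRing)).mp h1

variable {W} in
theorem algHom_ext_generic {L : Type*} [Field L] [Algebra k L] {f g : W.FunctionField →ₐ[k] L}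
    (hX : f W.genericX = g W.genericX) (hY : f W.genericY = g W.genericY) : f = g := by
  refine IsLocalization.algHom_ext (nonZeroDivisors W.CoordinateRing) ?_
  refine AdjoinRoot.algHom_ext' ?_ hY
  ext
  exact hX

variable {W} in
/-- A point with transcendental first coordinate over an extension field `L` defines an embedding of
the function field into `L`. -/
theorem exists_algHom_generic {L : Type*} [Field L] [Algebra k L] {x y : L}
    (hx : Transcendental k x) (h : (W.baseChange L).toAffine.Equation x y) :
    ∃ f : W.FunctionField →ₐ[k] L, f W.genericX = x ∧ f W.genericY = y := by
  let f : W.CoordinateRing →ₐ[k] L :=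
    AdjoinRoot.liftAlgHom W.polynomial (aeval x) y ((eval₂_polynomial x y).mpr h)
  have hf1 (p : k[X]) : f (AdjoinRoot.of _ p) = aeval x p := AdjoinRoot.liftAlgHom_of _ _ _ _ _
  have hf2 : f (AdjoinRoot.root _) = y := AdjoinRoot.liftAlgHom_root _ _ _ _
  have hf : Function.Injective f := by
    have : Module.Finite k[X] W.CoordinateRing := .of_basis (CoordinateRing.basis W)
    rw [injective_iff_map_eq_zero']
    have h1 : RingHom.ker f = ⊥ := by
      apply Ideal.eq_bot_of_comap_eq_bot (R := k[X])
      rw [eq_bot_iff]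
      intro p hp
      exact transcendental_iff.mp hx p ((hf1 p).symm.trans hp)
    intro a
    rw [← RingHom.mem_ker, h1, Ideal.mem_bot]
  refine ⟨IsFractionRing.liftAlgHom hf, ?_, ?_⟩
  · rw [IsFractionRing.liftAlgHom_apply, genericX, IsFractionRing.lift_algebraMap]
    exact (hf1 X).trans (aeval_X x)
  · rw [IsFractionRing.liftAlgHom_apply, genericY, IsFractionRing.lift_algebraMap]
    exact hf2

instance (L : Type*) [Field L] [Algebra k L] [W.IsElliptic] :
    (W.baseChange L).toAffine.IsElliptic :=
  inferInstanceAs (W.map (algebraMap k L)).IsElliptic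

section

variable [W.IsElliptic]

/-- The generic point of the curve, as a point over the function field. -/
noncomputable def genericPoint : (W.baseChange W.FunctionField).toAffine.Point :=
  .some W.genericX W.genericY (equation_iff_nonsingular.mp W.equation_generic)

variable [DecidableEq W.FunctionField]

variable {W} in
theorem algHom_ext_genericPoint {f g : W.FunctionField →ₐ[k] W.FunctionField}
    (h : Point.map (W' := W) f W.genericPoint = Point.map (W' := W) g W.genericPoint) : f = g := by
  rw [genericPoint, Point.map_some, Point.map_some, Point.some.injEq] at h
  exact algHom_ext_generic h.1 h.2

variable [DecidableEq k] [IsAlgClosed k]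

/-- The generic point and its translates by points over `k` have coordinates which are not in `k`,
so that there is an endomorphism of the function field which maps the generic point to its
translate: it is the effect on functions of the translation. -/
theorem exists_map_genericPoint (P : (W.baseChange k).toAffine.Point) :
    ∃ f : W.FunctionField →ₐ[k] W.FunctionField, Point.map (W' := W) f W.genericPoint =
      W.genericPoint + Point.baseChange (W' := W) k W.FunctionField P := by
  have hne (Q : (W.baseChange k).toAffine.Point) :
      W.genericPoint ≠ Point.baseChange (W' := W) k W.FunctionField Q := by
    intro h
    rcases Q with _ | ⟨x, y, hxy⟩
    · exact Point.some_ne_zero (equation_iff_nonsingular.mp W.equation_generic) h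
    · rw [genericPoint, Point.baseChange, Point.map_some, Point.some.injEq] at h
      exact (h.1 ▸ W.transcendental_genericX : Transcendental k (algebraMap k W.FunctionField x))
        (isAlgebraic_algebraMap x)
  obtain ⟨Q, hQ⟩ : ∃ Q, Q = W.genericPoint + Point.baseChange (W' := W) k W.FunctionField P :=
    ⟨_, rfl⟩
  have hne' (R : (W.baseChange k).toAffine.Point) :
      Q ≠ Point.baseChange (W' := W) k W.FunctionField R := by
    rintro rfl
    apply hne (R - P)
    rw [map_sub, hQ, add_sub_cancel_right]
  rcases Q with _ | ⟨x, y, hxy⟩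
  · exact absurd rfl (hne' 0)
  have hx : Transcendental k x := by
    intro hx
    have key (z : W.FunctionField) (hz : IsAlgebraic k z) : ∃ a, algebraMap k _ a = z :=
      minpoly.mem_range_of_degree_eq_one k z <|
        IsAlgClosed.degree_eq_one_of_irreducible k (minpoly.irreducible hz.isIntegral)
    obtain ⟨a, rfl⟩ := key x hx
    have hy : IsAlgebraic k y := by
      refine ⟨X ^ 2 + C (W.a₁ * a + W.a₃) * X - C (a ^ 3 + W.a₂ * a ^ 2 + W.a₄ * a + W.a₆), ?_, ?_⟩
      · refine Monic.ne_zero ?_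
        monicity!
      · have h := (equation_iff' _ _).mp hxy.1
        change y ^ 2 + algebraMap k _ W.a₁ * algebraMap k _ a * y + algebraMap k _ W.a₃ * y -
          (algebraMap k _ a ^ 3 + algebraMap k _ W.a₂ * algebraMap k _ a ^ 2 +
            algebraMap k _ W.a₄ * algebraMap k _ a + algebraMap k _ W.a₆) = 0 at h
        simp only [map_sub, map_add, map_mul, map_pow, aeval_X, aeval_C]
        linear_combination h
    obtain ⟨b, rfl⟩ := key y hy
    exact hne' (.some a b ((W.baseChange_nonsingular (Algebra.ofId k W.FunctionField).injective
      a b).mp hxy)) rfl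
  obtain ⟨f, hfX, hfY⟩ := exists_algHom_generic hx hxy.1
  refine ⟨f, ?_⟩
  rw [← hQ, genericPoint, Point.map_some]
  exact (Point.some.injEq ..).mpr ⟨hfX, hfY⟩

/-- The action of the points of an elliptic curve on its function field by translations. -/
theorem exists_injective_translation :
    ∃ t : Multiplicative (W.baseChange k).toAffine.Point →* (W.FunctionField ≃ₐ[k] W.FunctionField),
      Function.Injective t := by
  choose f hf using W.exists_map_genericPoint
  let t : Multiplicative (W.baseChange k).toAffine.Point →*
      (W.FunctionField →ₐ[k] W.FunctionField) :=
    { toFun P := f P.toAdd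
      map_one' := algHom_ext_genericPoint <| by
        rw [hf, toAdd_one, map_zero, add_zero, genericPoint, Point.map_some]
        rfl
      map_mul' P Q := algHom_ext_genericPoint <| by
        change _ = Point.map (W' := W) ((f P.toAdd).comp (f Q.toAdd)) W.genericPoint
        rw [← Point.map_map, hf, hf, map_add, hf, Point.map_baseChange, toAdd_mul,
          map_add, add_assoc] }
  refine ⟨(AlgEquiv.algHomUnitsEquiv k W.FunctionField).toMonoidHom.comp t.toHomUnits,
    (AlgEquiv.algHomUnitsEquiv k W.FunctionField).injective.comp fun P Q h => ?_⟩
  have h : f P.toAdd = f Q.toAdd := congrArg Units.val h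
  have h := congrArg (fun g => Point.map (W' := W) g W.genericPoint) h
  simp only [hf] at h
  exact Multiplicative.toAdd.injective
    (Point.map_injective (W' := W) (Algebra.ofId k W.FunctionField) (add_left_cancel h))

end

end WeierstrassCurve.Affine

/-! ### Heisenberg groups acting on `K(X)` -/

/-- A finite group of automorphisms of a function field of one variable fixes a nonconstant
function. -/
theorem exists_transcendental_forall_apply_eq {k K G : Type*} [Field k] [Field K] [Algebra k K]
    [Algebra.Transcendental k K] [Group G] [Finite G] (ρ : G →* (K ≃ₐ[k] K)) :
    ∃ x : K, Transcendental k x ∧ ∀ a, ρ a x = x := by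
  let F := IntermediateField.fixedField ρ.range
  have : Finite ρ.range := Set.finite_range ρ
  have : Algebra.IsAlgebraic F K :=
    ⟨fun x => (FixedPoints.isIntegral ρ.range K x).isAlgebraic⟩
  by_contra! h
  have : Algebra.IsAlgebraic k F := by
    refine ⟨fun x => ?_⟩
    by_contra hx
    obtain ⟨a, ha⟩ := h x fun hx' => hx ((isAlgebraic_algebraMap_iff F.val.injective).mp hx')
    exact ha (x.2 ⟨ρ a, a, rfl⟩)
  exact Algebra.transcendental_iff_not_isAlgebraic.mp ‹_› (Algebra.IsAlgebraic.trans k F K)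

/-- The element of the eigenspace of norm one, over the constants `k` of a function field `K` of one
variable: `K` is a finite extension of `k(x)` for a nonconstant function `x` fixed by the group. -/
theorem exists_apply_eq_mul_and_prod_eq_one_of_trdeg_eq_one {k K : Type*} [Field k] [IsAlgClosed k]
    [Field K] [Algebra k K] [Algebra.EssFiniteType k K] (hK : Algebra.trdeg k K = 1) {n : ℕ}
    [NeZero n] (ρ : Multiplicative (ZMod n × ZMod n) →* (K ≃ₐ[k] K))
    (hρ : Function.Injective ρ) {ζ : k} (hζ : ζ ^ n = 1) :
    ∃ g ≠ 0, ρ (.ofAdd (1, 0)) g = algebraMap k K ζ * g ∧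
      ∏ i ∈ Finset.range n, (ρ (.ofAdd (0, 1)) ^ i) g = 1 := by
  have : Algebra.Transcendental k K := trdeg_ne_zero_iff.mp (by simp [hK])
  obtain ⟨x, hx, hfix⟩ := exists_transcendental_forall_apply_eq ρ
  -- `x` is a transcendence basis of `K`, so that `K` is finite over `Q = k(x)`
  let v : Unit → K := fun _ => x
  have hv : AlgebraicIndependent k v := algebraicIndependent_unique_type_iff.mpr hx
  have hb : IsTranscendenceBasis k v :=
    hv.isTranscendenceBasis_of_lift_trdeg_le_of_finite (by simp [hK])
  have hb := hb.isAlgebraic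
  let Q := FractionRing (Polynomial k)
  have hinj : Function.Injective (Polynomial.aeval x : Polynomial k →ₐ[k] K) :=
    transcendental_iff_injective.mp hx
  let φ : Q →ₐ[k] K := IsFractionRing.liftAlgHom hinj
  have hφ (p : Polynomial k) : φ (algebraMap _ Q p) = Polynomial.aeval x p :=
    IsFractionRing.lift_algebraMap hinj p
  let _ : Algebra (Polynomial k) K :=
    (Polynomial.aeval x : Polynomial k →ₐ[k] K).toRingHom.toAlgebra
  let _ : Algebra Q K := φ.toRingHom.toAlgebra
  have : IsScalarTower (Polynomial k) Q K := .of_algebraMap_eq fun p => (hφ p).symm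
  have : IsScalarTower k Q K := .of_algebraMap_eq fun p => (φ.commutes p).symm
  have : Algebra.IsAlgebraic (Polynomial k) K := by
    let f : Polynomial k →ₐ[k] Algebra.adjoin k (Set.range v) :=
      Polynomial.aeval ⟨x, Algebra.subset_adjoin ⟨(), rfl⟩⟩
    have hf (p) : (f p : K) = Polynomial.aeval x p := Polynomial.aeval_subalgebra_coe _ _ _
    refine Algebra.IsAlgebraic.of_ringHom_of_comp_eq f (RingHom.id K) ?_ ?_ ?_
    · rintro ⟨y, hy⟩
      rw [Set.range_const, Algebra.adjoin_singleton_eq_range_aeval] at hy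
      obtain ⟨p, rfl⟩ := hy
      exact ⟨p, Subtype.ext (hf p)⟩
    · exact Function.injective_id
    · exact RingHom.ext hf
  have : Algebra.IsAlgebraic Q K :=
    (IsFractionRing.comap_isAlgebraic_iff (A := Polynomial k)).mp this
  have : Algebra.EssFiniteType Q K := .of_comp k Q K
  have : FiniteDimensional Q K := by
    obtain ⟨S, hS⟩ := IntermediateField.fg_top Q K
    have := IntermediateField.finiteDimensional_adjoin (K := Q) (S := (S : Set K))
      fun y _ => Algebra.IsIntegral.isIntegral y
    rw [hS] at this
    exact Module.Finite.of_surjective _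
      (IntermediateField.topEquiv (F := Q) (E := K)).toLinearEquiv.surjective
  have hcomm (a) (q : Q) : ρ a (algebraMap Q K q) = algebraMap Q K q := by
    refine DFunLike.congr_fun (IsLocalization.algHom_ext (nonZeroDivisors (Polynomial k)) ?_ :
      (ρ a : K →ₐ[k] K).comp φ = φ) q
    ext
    change ρ a (φ (algebraMap _ _ _)) = φ (algebraMap _ _ _)
    rw [hφ, Polynomial.aeval_X, hfix]
  let ρ' : Multiplicative (ZMod n × ZMod n) →* (K ≃ₐ[Q] K) :=
    { toFun := fun a => AlgEquiv.ofRingEquiv (f := (ρ a).toRingEquiv) (hcomm a)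
      map_one' := by
        ext y
        exact DFunLike.congr_fun (map_one ρ) y
      map_mul' := fun a b => by
        ext y
        exact DFunLike.congr_fun (map_mul ρ a b) y }
  have hρ' (a) (y) : ρ' a y = ρ a y := rfl
  have hpow (a) (i : ℕ) (y) : (ρ' a ^ i) y = (ρ a ^ i) y := by
    rw [← map_pow ρ', ← map_pow ρ, hρ']
  obtain ⟨g, hg, h1, h2⟩ := exists_apply_eq_mul_and_prod_eq_one (k := k) ρ'
    (fun a b h => hρ (AlgEquiv.ext fun y => DFunLike.congr_fun h y)) (ζ := algebraMap k Q ζ)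
    (by rw [← map_pow, hζ, map_one])
  refine ⟨g, hg, ?_, ?_⟩
  · rw [← hρ', h1, ← IsScalarTower.algebraMap_apply]
  · simpa only [hpow] using h2

namespace WeierstrassCurve.Affine

instance {k : Type*} [Field k] (W : WeierstrassCurve.Affine k) :
    Algebra.EssFiniteType k W.FunctionField := by
  have : Module.Finite (Polynomial k) W.CoordinateRing := .of_basis (CoordinateRing.basis W)
  have : Algebra.FiniteType k W.CoordinateRing :=
    .trans (S := Polynomial k) inferInstance inferInstance
  have : Algebra.EssFiniteType W.CoordinateRing W.FunctionField :=
    .of_isLocalization _ (nonZeroDivisors W.CoordinateRing)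
  exact .comp k W.CoordinateRing W.FunctionField

theorem trdeg_functionField {k : Type*} [Field k] (W : WeierstrassCurve.Affine k) :
    Algebra.trdeg k W.FunctionField = 1 := by
  have : Module.Finite (Polynomial k) W.CoordinateRing := .of_basis (CoordinateRing.basis W)
  have : Algebra.IsAlgebraic W.CoordinateRing W.FunctionField :=
    IsLocalization.isAlgebraic _ (nonZeroDivisors W.CoordinateRing)
  have := Algebra.IsAlgebraic.trans (Polynomial k) W.CoordinateRing W.FunctionField
  rw [← trdeg_add_eq k (Polynomial k), Polynomial.trdeg_of_isDomain, trdeg_eq_zero,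
    add_zero]

end WeierstrassCurve.Affine

section

open Polynomial

variable {k K L : Type*} [Field k] [Field K] [Field L] [Algebra K[X] L] [IsFractionRing K[X] L]
  [Algebra k L]

theorem algEquiv_ext_of_isFractionRing_polynomial {f g : L ≃ₐ[k] L}
    (hC : ∀ c, f (algebraMap K[X] L (C c)) = g (algebraMap K[X] L (C c)))
    (hX : f (algebraMap K[X] L X) = g (algebraMap K[X] L X)) : f = g := by
  refine AlgEquiv.ext fun y => RingHom.congr_fun
    (IsLocalization.ringHom_ext (nonZeroDivisors K[X]) ?_ : (f : L →+* L) = g) y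
  exact Polynomial.ringHom_ext hC hX

variable [Algebra k K] [IsScalarTower k K[X] L]

/-- The automorphism of `K(X)` given by `τ` on the coefficients and by `X ↦ u X`. -/
theorem exists_algEquiv_C_X (τ : K ≃ₐ[k] K) {u : K} (hu : u ≠ 0) :
    ∃ f : L ≃ₐ[k] L, (∀ c, f (algebraMap K[X] L (C c)) = algebraMap K[X] L (C (τ c))) ∧
      f (algebraMap K[X] L X) = algebraMap K[X] L (C u) * algebraMap K[X] L X := by
  let _ : Invertible u := invertibleOfNonzero hu
  let e : K[X] ≃ₐ[k] K[X] := (mapAlgEquiv τ).trans ((algEquivCMulXAddC u 0).restrictScalars k)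
  refine ⟨IsFractionRing.algEquivOfAlgEquiv e, fun c => ?_, ?_⟩
  · rw [IsFractionRing.algEquivOfAlgEquiv_algebraMap]
    simp [e]
  · rw [IsFractionRing.algEquivOfAlgEquiv_algebraMap, ← map_mul]
    simp [e]

/-- The group of automorphisms of `K(X)` contains large Heisenberg groups: if `σ` and `τ` generate
the group `ℤ / n × ℤ / n` of automorphisms of `K`, and `g` is an element of norm one for `τ` with
`σ g = ζ g`, then `X ↦ X` over `σ` and `X ↦ g X` over `τ` are automorphisms of order dividing `n` of
`K(X)` whose commutator is `X ↦ ζ X`. -/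
theorem not_isJordanGroup_algEquiv [IsAlgClosed k] [CharZero k] [Algebra.EssFiniteType k K]
    (hK : Algebra.trdeg k K = 1)
    (h : ∀ N : ℕ, ∃ n > N, ∃ ρ : Multiplicative (ZMod n × ZMod n) →* (K ≃ₐ[k] K),
      Function.Injective ρ) : ¬ IsJordanGroup (L ≃ₐ[k] L) := by
  apply not_isJordanGroup_of_heisenberg
  intro N
  obtain ⟨n, hn, ρ, hρ⟩ := h N
  have : NeZero n := ⟨by omega⟩
  obtain ⟨ζ, hζ⟩ := HasEnoughRootsOfUnity.exists_primitiveRoot k n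
  obtain ⟨g, hg, hσg, hτg⟩ :=
    exists_apply_eq_mul_and_prod_eq_one_of_trdeg_eq_one hK ρ hρ hζ.pow_eq_one
  set σ := ρ (.ofAdd (1, 0)) with hσ
  set τ := ρ (.ofAdd (0, 1)) with hτ
  have hσn : σ ^ n = 1 := by
    rw [hσ, ← map_pow ρ, ← ofAdd_nsmul, Prod.smul_mk, smul_zero, nsmul_one, ZMod.natCast_self]
    exact map_one ρ
  have hτn : τ ^ n = 1 := by
    rw [hτ, ← map_pow ρ, ← ofAdd_nsmul, Prod.smul_mk, smul_zero, nsmul_one, ZMod.natCast_self]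
    exact map_one ρ
  have hcomm : σ * τ = τ * σ := by rw [hσ, hτ, ← map_mul ρ, ← map_mul ρ, mul_comm]
  have hζ0 : algebraMap k K ζ ≠ 0 := by
    rw [Ne, map_eq_zero]
    exact hζ.ne_zero (NeZero.ne n)
  obtain ⟨a, haC, haX⟩ := exists_algEquiv_C_X (L := L) σ one_ne_zero
  obtain ⟨b, hbC, hbX⟩ := exists_algEquiv_C_X (L := L) τ hg
  obtain ⟨z, hzC, hzX⟩ := exists_algEquiv_C_X (L := L) (1 : K ≃ₐ[k] K) hζ0
  have hpow {f : L ≃ₐ[k] L} {θ : K ≃ₐ[k] K} {u : K}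
      (hC : ∀ c, f (algebraMap K[X] L (C c)) = algebraMap K[X] L (C (θ c)))
      (hX : f (algebraMap K[X] L X) = algebraMap K[X] L (C u) * algebraMap K[X] L X) (i : ℕ) :
      (∀ c, (f ^ i) (algebraMap K[X] L (C c)) = algebraMap K[X] L (C ((θ ^ i) c))) ∧
      (f ^ i) (algebraMap K[X] L X) =
        algebraMap K[X] L (C (∏ j ∈ Finset.range i, (θ ^ j) u)) * algebraMap K[X] L X := by
    induction i with
    | zero => simp
    | succ i ih =>
      refine ⟨fun c => ?_, ?_⟩
      · rw [pow_succ, AlgEquiv.mul_apply, hC, ih.1, pow_succ, AlgEquiv.mul_apply]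
      · rw [pow_succ, AlgEquiv.mul_apply, hX, map_mul, ih.1, ih.2, Finset.prod_range_succ, C_mul,
          map_mul]
        ring
  have hone {f : L ≃ₐ[k] L} {θ : K ≃ₐ[k] K} {u : K}
      (hC : ∀ c, f (algebraMap K[X] L (C c)) = algebraMap K[X] L (C (θ c)))
      (hX : f (algebraMap K[X] L X) = algebraMap K[X] L (C u) * algebraMap K[X] L X)
      (hθ : θ ^ n = 1) (hu : ∏ j ∈ Finset.range n, (θ ^ j) u = 1) : f ^ n = 1 := by
    obtain ⟨h1, h2⟩ := hpow hC hX n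
    refine algEquiv_ext_of_isFractionRing_polynomial (K := K) (fun c => ?_) ?_
    · rw [h1, hθ]
      rfl
    · rw [h2, hu]
      simp
  have hX0 : algebraMap K[X] L X ≠ 0 := by simp
  refine ⟨n, hn, a, b, z, ?_, ?_, ?_,
    hone haC haX hσn (by simp), hone hbC hbX hτn hτg, ?_⟩
  · refine algEquiv_ext_of_isFractionRing_polynomial (K := K) (fun c => ?_) ?_
    · simp [haC, hzC]
    · simp [haX, hzX, haC]
  · refine algEquiv_ext_of_isFractionRing_polynomial (K := K) (fun c => ?_) ?_
    · simp [hbC, hzC]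
    · simp [hbX, hzX, hbC, hzC]
      ring
  · refine algEquiv_ext_of_isFractionRing_polynomial (K := K) (fun c => ?_) ?_
    · simp only [AlgEquiv.mul_apply, haC, hbC, hzC]
      rw [← AlgEquiv.mul_apply, hcomm]
      rfl
    · simp only [AlgEquiv.mul_apply, haX, hbX, hzX, map_mul, haC, hzC, hσg, map_one, one_mul,
        AlgEquiv.one_apply]
      ring
  · rw [hζ.eq_orderOf, orderOf_eq_orderOf_iff]
    intro i
    obtain ⟨h1, h2⟩ := hpow hzC hzX i
    simp only [one_pow, AlgEquiv.one_apply, Finset.prod_const, Finset.card_range] at h1 h2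
    refine ⟨fun h => ?_, fun h => algEquiv_ext_of_isFractionRing_polynomial (k := k) h1 ?_⟩
    · rw [h, AlgEquiv.one_apply, eq_comm, mul_eq_right₀ hX0] at h2
      rw [← map_one (algebraMap K[X] L), (IsFractionRing.injective K[X] L).eq_iff, ← C_1,
        C_inj] at h2
      rwa [← map_pow, map_eq_one_iff _ (algebraMap k K).injective] at h2
    · rw [h2, ← map_pow, h]
      simp

end

/-! ### Automorphisms of the function field as birational automorphisms -/

namespace AlgebraicGeometry.Scheme

theorem RationalMap.compHom_comp {X Y Z T : Scheme.{u}} (f : X ⤏ Y) (g : Y ⟶ Z) (h : Z ⟶ T) :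
    f.compHom (g ≫ h) = (f.compHom g).compHom h := by
  obtain ⟨f, rfl⟩ := f.exists_rep
  simp only [← RationalMap.compHom_toRationalMap]
  congr 1

theorem RationalMap.compHom_injective {X Y Z : Scheme.{u}} (j : Y ⟶ Z) [Mono j] :
    Function.Injective fun f : X ⤏ Y => f.compHom j := by
  intro f g h
  obtain ⟨f, rfl⟩ := f.exists_rep
  obtain ⟨g, rfl⟩ := g.exists_rep
  obtain ⟨W, hW, hf, hg, h⟩ := PartialMap.toRationalMap_eq_iff.mp h
  refine PartialMap.toRationalMap_eq_iff.mpr ⟨W, hW, hf, hg, ?_⟩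
  change X.homOfLE hf ≫ f.hom ≫ j = X.homOfLE hg ≫ g.hom ≫ j at h
  exact (cancel_mono j).mp h

section

variable {U X : Scheme.{u}} (j : U ⟶ X) [IsOpenImmersion j]

/-- The rational map which is inverse to a dominant open immersion. -/
noncomputable def Hom.inverseRationalMap [IsDominant j] : X ⤏ U :=
  PartialMap.toRationalMap ⟨j.opensRange, j.denseRange, j.isoOpensRange.inv⟩

instance [IsDominant j] : j.inverseRationalMap.IsDominant := by
  rw [Hom.inverseRationalMap, PartialMap.isDominant_toRationalMap_iff]
  change IsDominant j.isoOpensRange.inv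
  infer_instance

theorem Hom.inverseRationalMap_compHom [IsDominant j] :
    j.inverseRationalMap.compHom j = RationalMap.id X := by
  rw [Hom.inverseRationalMap, ← RationalMap.compHom_toRationalMap, PartialMap.toRationalMap_eq_iff]
  refine ⟨j.opensRange, j.denseRange, le_rfl, le_top, ?_⟩
  change X.homOfLE le_rfl ≫ j.isoOpensRange.inv ≫ j = X.homOfLE le_top ≫ X.topIso.hom ≫ 𝟙 X
  simp

theorem Hom.comp_inverseRationalMap [IsDominant j] [IrreducibleSpace U] [IrreducibleSpace X] :
    j.toRationalMap.comp j.inverseRationalMap = RationalMap.id U := by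
  apply RationalMap.compHom_injective j
  beta_reduce
  rw [← RationalMap.comp_toRationalMap, RationalMap.comp_assoc, RationalMap.comp_toRationalMap,
    inverseRationalMap_compHom, RationalMap.comp_id, RationalMap.id_compHom]

theorem Hom.comp_inverseRationalMap_comp [IsDominant j] [IrreducibleSpace U] [IrreducibleSpace X]
    {Z : Scheme.{u}} (f : U ⤏ Z) : j.toRationalMap.comp (j.inverseRationalMap.comp f) = f := by
  rw [← RationalMap.comp_assoc]
  simp only [comp_inverseRationalMap, RationalMap.id_comp]

end

end AlgebraicGeometry.Scheme

namespace DominantRationalSelfMap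

open Scheme

variable {U X S : Scheme.{u}} {s : X ⟶ S} {t : U ⟶ S} [IrreducibleSpace U] [IrreducibleSpace X]

theorem mul_toRationalMap (f g : DominantRationalSelfMap s) :
    (f * g).toRationalMap = g.toRationalMap.comp f.toRationalMap := rfl

theorem one_toRationalMap : (1 : DominantRationalSelfMap s).toRationalMap = RationalMap.id X := rfl

/-- Dominant rational self-maps of a dense open subscheme, as rational self-maps of the whole
scheme. -/
noncomputable def ofOpenImmersion (j : U ⟶ X) [IsOpenImmersion j] [IsDominant j] (h : j ≫ s = t) :
    DominantRationalSelfMap t →* DominantRationalSelfMap s where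
  toFun f :=
    { toRationalMap := j.inverseRationalMap.comp (f.toRationalMap.comp j.toRationalMap)
      isDominant := inferInstance
      comp_structure := by
        have : Nonempty S := ⟨s (Classical.arbitrary X)⟩
        rw [← RationalMap.comp_toRationalMap, RationalMap.comp_assoc, RationalMap.comp_assoc,
          RationalMap.comp_toRationalMap, Hom.toRationalMap, ← RationalMap.compHom_toRationalMap,
          Hom.toPartialMap_compHom, h, RationalMap.comp_toRationalMap, f.comp_structure,
          RationalMap.comp_toRationalMap, ← h, RationalMap.compHom_comp,
          Hom.inverseRationalMap_compHom, RationalMap.id_compHom] }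
  map_one' := by
    ext1
    change j.inverseRationalMap.comp ((RationalMap.id U).comp j.toRationalMap) = RationalMap.id X
    rw [RationalMap.id_comp, RationalMap.comp_toRationalMap, Hom.inverseRationalMap_compHom]
  map_mul' f g := by
    ext1
    change j.inverseRationalMap.comp ((g.toRationalMap.comp f.toRationalMap).comp j.toRationalMap) =
      (j.inverseRationalMap.comp (g.toRationalMap.comp j.toRationalMap)).comp
        (j.inverseRationalMap.comp (f.toRationalMap.comp j.toRationalMap))
    rw [RationalMap.comp_assoc, RationalMap.comp_assoc, RationalMap.comp_assoc,
      Hom.comp_inverseRationalMap_comp]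

theorem ofOpenImmersion_injective (j : U ⟶ X) [IsOpenImmersion j] [IsDominant j] (h : j ≫ s = t) :
    Function.Injective (ofOpenImmersion j h) := by
  intro f g hfg
  have h1 : j.inverseRationalMap.comp (f.toRationalMap.comp j.toRationalMap) =
    j.inverseRationalMap.comp (g.toRationalMap.comp j.toRationalMap) := congrArg toRationalMap hfg
  replace h1 := congrArg j.toRationalMap.comp h1
  rw [Hom.comp_inverseRationalMap_comp, Hom.comp_inverseRationalMap_comp,
    RationalMap.comp_toRationalMap, RationalMap.comp_toRationalMap] at h1
  exact ext (RationalMap.compHom_injective j h1)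

end DominantRationalSelfMap

namespace AlgebraicGeometry.Scheme

/-- If a dominant partial map acts on generic points by `φ`, then composition with it is, on generic
points, composition with `φ`. -/
theorem PartialMap.fromFunctionField_comp {X Y Z : Scheme.{u}} [IrreducibleSpace X]
    [IrreducibleSpace Y] (f : X.PartialMap Y) [IsDominant f.hom] (g : Y.PartialMap Z)
    {φ : Spec X.functionField ⟶ Spec Y.functionField}
    (h : f.fromFunctionField = φ ≫ Y.fromSpecStalk (genericPoint Y)) :
    (f.comp g).fromFunctionField = φ ≫ g.fromFunctionField := by
  have hη (V : Y.Opens) (hV : Dense (V : Set Y)) : genericPoint Y ∈ V :=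
    (genericPoint_specializes _).mem_open V.2 hV.nonempty.choose_spec
  have hξ (V : X.Opens) (hV : Dense (V : Set X)) : genericPoint X ∈ V :=
    (genericPoint_specializes _).mem_open V.2 hV.nonempty.choose_spec
  change f.domain.fromSpecStalkOfMem _ (hξ _ f.dense_domain) ≫ f.hom = _ at h
  let D := f.domain.ι ''ᵁ f.hom ⁻¹ᵁ g.domain
  have hD := hξ D (f.comp g).dense_domain
  have h1 : D.fromSpecStalkOfMem _ hD ≫ (f.domain.ι.isoImage _).inv ≫ (f.hom ⁻¹ᵁ g.domain).ι =
      f.domain.fromSpecStalkOfMem _ (hξ _ f.dense_domain) := by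
    rw [← cancel_mono f.domain.ι]
    simp [D]
  have h2 : D.fromSpecStalkOfMem _ hD ≫ (f.domain.ι.isoImage _).inv ≫ (f.hom ∣_ g.domain) =
      φ ≫ g.domain.fromSpecStalkOfMem _ (hη _ g.dense_domain) := by
    rw [← cancel_mono g.domain.ι]
    simp only [Category.assoc, Opens.fromSpecStalkOfMem_ι, ← h, morphismRestrict_ι]
    rw [← h1]
    simp only [Category.assoc]
  change D.fromSpecStalkOfMem _ hD ≫ (f.domain.ι.isoImage _).inv ≫ (f.hom ∣_ g.domain) ≫ g.hom =
    φ ≫ g.domain.fromSpecStalkOfMem _ (hη _ g.dense_domain) ≫ g.hom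
  simpa only [Category.assoc] using congr($h2 ≫ g.hom)

theorem RationalMap.fromFunctionField_comp {X Y Z : Scheme.{u}} [IrreducibleSpace X]
    [IrreducibleSpace Y] (f : X ⤏ Y) [f.IsDominant] (g : Y ⤏ Z)
    {φ : Spec X.functionField ⟶ Spec Y.functionField}
    (h : f.fromFunctionField = φ ≫ Y.fromSpecStalk (genericPoint Y)) :
    (f.comp g).fromFunctionField = φ ≫ g.fromFunctionField := by
  rw [← g.toRationalMap_representative, RationalMap.comp_def]
  refine PartialMap.fromFunctionField_comp _ _ (h ▸ ?_)
  rw [← RationalMap.fromFunctionField_toRationalMap, RationalMap.toRationalMap_representative]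

theorem RationalMap.isDominant_of_fromFunctionField {X Y : Scheme.{u}} [IrreducibleSpace X]
    (f : X ⤏ Y) (h : IsDominant f.fromFunctionField) : f.IsDominant := by
  obtain ⟨f, rfl⟩ := f.exists_rep
  rw [PartialMap.isDominant_toRationalMap_iff]
  exact IsDominant.of_comp _ f.hom (H := h)

section

variable {k : Type u} {R : CommRingCat.{u}} {L : Type u} [Field k] [IsDomain R] [Algebra k R]
  [Field L] [Algebra R L] [IsFractionRing R L] [Algebra k L] [IsScalarTower k R L]

/-- Conjugation by a ring isomorphism, as a functor on endomorphisms. -/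
noncomputable def conjHom {L : Type u} [CommRing L] {F : CommRingCat.{u}} (e : L ≃+* F)
    (ψ : L →+* L) : F ⟶ F :=
  CommRingCat.ofHom (((e : L →+* F).comp ψ).comp (e.symm : F →+* L))

theorem conjHom_apply {L : Type u} [CommRing L] {F : CommRingCat.{u}} (e : L ≃+* F)
    (ψ : L →+* L) (x : L) : conjHom e ψ (e x) = e (ψ x) := by
  simp [conjHom]

theorem conjHom_comp {L : Type u} [CommRing L] {F : CommRingCat.{u}} (e : L ≃+* F)
    (ψ χ : L →+* L) : conjHom e (χ.comp ψ) = conjHom e ψ ≫ conjHom e χ := by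
  ext x
  simp [conjHom]

theorem conjHom_id {L : Type u} [CommRing L] {F : CommRingCat.{u}} (e : L ≃+* F) :
    conjHom e (RingHom.id L) = 𝟙 F := by
  ext x
  simp [conjHom]

variable (k R) in
/-- The structure morphism of the spectrum of a `k`-algebra. -/
noncomputable def specToSpec : Spec R ⟶ Spec (.of k) :=
  Spec.map (CommRingCat.ofHom (algebraMap k R))

variable (R L) in
/-- The isomorphism of a fraction field of `R` with the function field of `Spec R`. -/
noncomputable def functionFieldEquiv : L ≃ₐ[R] (Spec R).functionField :=
  IsLocalization.algEquiv (nonZeroDivisors R) L (Spec R).functionField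

variable (R) in
/-- An endomorphism of a fraction field of `R` as an endomorphism of the function field of
`Spec R`. -/
noncomputable def functionFieldHom (ψ : L →ₐ[k] L) :
    (Spec R).functionField ⟶ (Spec R).functionField :=
  conjHom (functionFieldEquiv R L).toRingEquiv ψ

theorem fromSpecStalk_genericPoint : (Spec R).fromSpecStalk (genericPoint (Spec R)) =
    Spec.map (CommRingCat.ofHom (algebraMap R (Spec R).functionField)) :=
  Spec.fromSpecStalk_eq' ..

omit [Algebra k R] [IsScalarTower k R L] in
theorem functionFieldHom_comp (ψ χ : L →ₐ[k] L) :
    functionFieldHom R (χ.comp ψ) = functionFieldHom R ψ ≫ functionFieldHom R χ := by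
  exact conjHom_comp _ (ψ : L →+* L) (χ : L →+* L)

omit [Algebra k R] [IsScalarTower k R L] in
theorem functionFieldHom_algebraMap (ψ : L →ₐ[k] L) (r : R) :
    functionFieldHom R ψ (algebraMap R _ r) =
      functionFieldEquiv R L (ψ (algebraMap R L r)) := by
  rw [← (functionFieldEquiv R L).commutes]
  exact conjHom_apply _ _ _

variable (R) in
/-- The generic point of `Spec R`, twisted by an endomorphism of the function field. -/
noncomputable def specFunctionFieldHom (ψ : L →ₐ[k] L) : Spec (Spec R).functionField ⟶ Spec R :=
  Spec.map (functionFieldHom R ψ) ≫ (Spec R).fromSpecStalk _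

omit [Algebra k R] [IsScalarTower k R L] in
theorem specFunctionFieldHom_eq (ψ : L →ₐ[k] L) :
    specFunctionFieldHom R ψ = Spec.map
      (CommRingCat.ofHom (algebraMap R (Spec R).functionField) ≫ functionFieldHom R ψ) := by
  rw [specFunctionFieldHom, fromSpecStalk_genericPoint, Spec.map_comp]

theorem specFunctionFieldHom_comp (ψ : L →ₐ[k] L) :
    specFunctionFieldHom R ψ ≫ specToSpec k R =
      (Spec R).fromSpecStalk _ ≫ specToSpec k R := by
  rw [specToSpec, specFunctionFieldHom_eq, fromSpecStalk_genericPoint, ← Spec.map_comp,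
    ← Spec.map_comp]
  congr 1
  ext c
  refine (functionFieldHom_algebraMap ψ (algebraMap k R c)).trans ?_
  rw [← IsScalarTower.algebraMap_apply, AlgHom.commutes, IsScalarTower.algebraMap_apply k R L,
    AlgEquiv.commutes]
  rfl

omit [Algebra k R] [IsScalarTower k R L] in
theorem specFunctionFieldHom_injective :
    Function.Injective (specFunctionFieldHom R : (L →ₐ[k] L) → _) := by
  intro ψ χ h
  rw [specFunctionFieldHom_eq, specFunctionFieldHom_eq] at h
  have h := Spec.map_injective h
  have h (r : R) : ψ (algebraMap R L r) = χ (algebraMap R L r) := by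
    apply (functionFieldEquiv R L).injective
    rw [← functionFieldHom_algebraMap, ← functionFieldHom_algebraMap]
    exact congr($h r)
  refine AlgHom.ext fun y => RingHom.congr_fun (IsLocalization.ringHom_ext (nonZeroDivisors R) ?_ :
    (ψ : L →+* L) = χ) y
  exact RingHom.ext h

instance (ψ : L →ₐ[k] L) : IsDominant (specFunctionFieldHom R ψ) := by
  rw [specFunctionFieldHom_eq]
  refine ⟨(PrimeSpectrum.denseRange_comap_iff_ker_le_nilRadical _).mpr ?_⟩
  rw [(RingHom.injective_iff_ker_eq_bot _).mp]
  · exact bot_le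
  · intro a b h
    have h : functionFieldHom R ψ (algebraMap R _ a) =
      functionFieldHom R ψ (algebraMap R _ b) := h
    rw [functionFieldHom_algebraMap, functionFieldHom_algebraMap] at h
    exact IsFractionRing.injective R L (ψ.injective ((functionFieldEquiv R L).injective h))

end

end AlgebraicGeometry.Scheme

namespace DominantRationalSelfMap

open Scheme

variable {k : Type u} {R : CommRingCat.{u}} {L : Type u} [Field k] [IsDomain R] [Algebra k R]
  [Algebra.FiniteType k R] [Field L] [Algebra R L] [IsFractionRing R L] [Algebra k L]
  [IsScalarTower k R L]

instance : LocallyOfFiniteType (specToSpec k R) := by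
  rw [specToSpec]
  rw [HasRingHomProperty.Spec_iff (P := @LocallyOfFiniteType)]
  exact RingHom.finiteType_algebraMap.mpr inferInstance

variable (R) in
/-- The rational self-map of `Spec R` with given action on the function field. -/
noncomputable def ofAlgHom (ψ : L →ₐ[k] L) :
    DominantRationalSelfMap (specToSpec k R) where
  toRationalMap := RationalMap.ofFunctionField _ _ (specFunctionFieldHom R ψ)
    (specFunctionFieldHom_comp ψ)
  isDominant := RationalMap.isDominant_of_fromFunctionField _ (by
    rw [RationalMap.fromFunctionField_ofFunctionField]
    infer_instance)
  comp_structure := (RationalMap.equivFunctionField _ _ ⟨_, specFunctionFieldHom_comp ψ⟩).2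

theorem fromFunctionField_ofAlgHom (ψ : L →ₐ[k] L) :
    (ofAlgHom R ψ).toRationalMap.fromFunctionField = specFunctionFieldHom R ψ :=
  RationalMap.fromFunctionField_ofFunctionField _ _ _ _

theorem ofAlgHom_injective : Function.Injective (ofAlgHom R : (L →ₐ[k] L) → _) := by
  intro ψ χ h
  apply specFunctionFieldHom_injective (R := R)
  rw [← fromFunctionField_ofAlgHom, h, fromFunctionField_ofAlgHom]

theorem ofAlgHom_comp (ψ χ : L →ₐ[k] L) :
    ofAlgHom R (χ.comp ψ) = ofAlgHom R ψ * ofAlgHom R χ := by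
  ext1
  apply RationalMap.eq_of_fromFunctionField_eq
  rw [mul_toRationalMap, RationalMap.fromFunctionField_comp _ _ (fromFunctionField_ofAlgHom χ),
    fromFunctionField_ofAlgHom, fromFunctionField_ofAlgHom, specFunctionFieldHom,
    specFunctionFieldHom, functionFieldHom_comp, Spec.map_comp, Category.assoc]

theorem ofAlgHom_id : ofAlgHom R (AlgHom.id k L) = 1 := by
  ext1
  apply RationalMap.eq_of_fromFunctionField_eq
  have h : functionFieldHom R (AlgHom.id k L) = 𝟙 _ := conjHom_id _
  rw [one_toRationalMap, fromFunctionField_ofAlgHom, specFunctionFieldHom, h, Spec.map_id,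
    Category.id_comp, RationalMap.fromFunctionField_toRationalMap, PartialMap.fromFunctionField,
    PartialMap.fromSpecStalkOfMem_toPartialMap, Category.comp_id]

theorem ofAlgHom_mul_inv (ψ χ : L ≃ₐ[k] L) :
    ofAlgHom R ((ψ * χ)⁻¹ : L ≃ₐ[k] L).toAlgHom =
      ofAlgHom R (ψ⁻¹ : L ≃ₐ[k] L).toAlgHom * ofAlgHom R (χ⁻¹ : L ≃ₐ[k] L).toAlgHom := by
  rw [← ofAlgHom_comp, mul_inv_rev]
  rfl

variable (R) in
/-- An automorphism of the function field gives a birational automorphism of `Spec R`. The inverse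
makes the contravariant construction a homomorphism. -/
noncomputable def ofAlgEquiv :
    (L ≃ₐ[k] L) →* DominantRationalSelfMap (specToSpec k R) where
  toFun ψ := ofAlgHom R (ψ⁻¹ : L ≃ₐ[k] L).toAlgHom
  map_one' := ofAlgHom_id
  map_mul' ψ χ := ofAlgHom_mul_inv ψ χ

theorem ofAlgEquiv_injective : Function.Injective (ofAlgEquiv R : (L ≃ₐ[k] L) →* _) := by
  intro ψ χ h
  have h := ofAlgHom_injective (R := R) h
  exact inv_injective (AlgEquiv.coe_toAlgHom_injective h)

end DominantRationalSelfMap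

/-- The automorphisms of the function field of a scheme `X` over `k` act on `X` by birational
automorphisms. The function field is given as the fraction field of the coordinate ring of an affine
chart. -/
theorem exists_injective_bir {k : Type u} {R : CommRingCat.{u}} {L : Type u} [Field k] [IsDomain R]
    [Algebra k R] [Algebra.FiniteType k R] [Field L] [Algebra R L] [IsFractionRing R L]
    [Algebra k L] [IsScalarTower k R L] {X : Scheme.{u}} [IrreducibleSpace X]
    {s : X ⟶ Spec (.of k)} (j : Spec R ⟶ X) [IsOpenImmersion j]
    (h : j ≫ s = Scheme.specToSpec k R) :
    ∃ f : (L ≃ₐ[k] L) →* Bir s, Function.Injective f := by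
  have : IsDominant j := ⟨j.isOpenEmbedding.isOpen_range.dense (Set.range_nonempty j)⟩
  let f := (DominantRationalSelfMap.ofOpenImmersion j h).comp
    (DominantRationalSelfMap.ofAlgEquiv (k := k) (L := L) R)
  refine ⟨f.toHomUnits, fun a b hab => ?_⟩
  have hab : f a = f b := congrArg Units.val hab
  exact DominantRationalSelfMap.ofAlgEquiv_injective
    (DominantRationalSelfMap.ofOpenImmersion_injective j h hab)

/-! ### An affine chart of the product -/

open Scheme in
/-- A chart of a projective spectrum: `Spec B` for a dehomogenization `g : A → B`, which sends an
element `f` of degree one to one. -/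
theorem exists_isOpenImmersion_proj {k A B : Type u} [Field k] [CommRing A] [Algebra k A]
    (𝒜 : ℕ → Submodule k A) [GradedAlgebra 𝒜] [CommRing B] [Algebra k B] {f : A} (hf : f ∈ 𝒜 1)
    (g : A →ₐ[k] B) (hgf : g f = 1) (hinj : ∀ n, ∀ a ∈ 𝒜 n, g a = 0 → a = 0)
    (hsurj : Algebra.adjoin k (g '' 𝒜 1) = ⊤) :
    ∃ j : Spec (.of B) ⟶ Proj 𝒜, IsOpenImmersion j ∧
      j ≫ projToSpec k 𝒜 = Scheme.specToSpec k (.of B) := by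
  have hu : IsUnit (g.toRingHom f) := by simp [hgf]
  let γ : HomogeneousLocalization.Away 𝒜 f →+* B :=
    (IsLocalization.Away.lift f hu).comp (algebraMap _ (Localization.Away f))
  have hγ (n a ha) : γ (.mk 𝒜 hf n a ha) = g a := by
    rw [RingHom.comp_apply, HomogeneousLocalization.algebraMap_apply,
      HomogeneousLocalization.Away.val_mk, Localization.mk_eq_mk']
    have h := congrArg (IsLocalization.Away.lift f hu)
      (IsLocalization.mk'_spec (Localization.Away f) a (⟨f ^ n, n, rfl⟩ : Submonoid.powers f))
    rw [map_mul, IsLocalization.Away.lift_eq, IsLocalization.Away.lift_eq] at h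
    simpa [hgf] using h
  have hγi : Function.Injective γ := by
    rw [injective_iff_map_eq_zero]
    intro z hz
    obtain ⟨n, a, ha, rfl⟩ := HomogeneousLocalization.Away.mk_surjective _ hf z
    rw [hγ] at hz
    apply HomogeneousLocalization.val_injective
    rw [HomogeneousLocalization.Away.val_mk, hinj _ a ha hz, Localization.mk_zero,
      HomogeneousLocalization.val_zero]
  have hγk (c : k) : γ (HomogeneousLocalization.fromZeroRingHom 𝒜 (.powers f)
      (algebraMap k (𝒜 0) c)) = algebraMap k B c := by
    have h : HomogeneousLocalization.fromZeroRingHom 𝒜 (.powers f) (algebraMap k (𝒜 0) c) =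
        HomogeneousLocalization.Away.mk 𝒜 hf 0 (algebraMap k A c) (by
          rw [zero_smul]
          exact SetLike.algebraMap_mem_graded 𝒜 c) := by
      apply HomogeneousLocalization.val_injective
      simp [HomogeneousLocalization.fromZeroRingHom]
      rfl
    rw [h, hγ, AlgHom.commutes]
  have hγs : Function.Surjective γ := by
    intro y
    have hy : y ∈ Algebra.adjoin k (g '' 𝒜 1) := hsurj ▸ Algebra.mem_top
    induction hy using Algebra.adjoin_induction with
    | mem x hx =>
      obtain ⟨a, ha, rfl⟩ := hx
      exact ⟨.mk 𝒜 hf 1 a (by simpa using! ha), hγ _ _ _⟩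
    | algebraMap c => exact ⟨_, hγk c⟩
    | add x y _ _ hx hy =>
      obtain ⟨a, rfl⟩ := hx
      obtain ⟨b, rfl⟩ := hy
      exact ⟨a + b, map_add γ a b⟩
    | mul x y _ _ hx hy =>
      obtain ⟨a, rfl⟩ := hx
      obtain ⟨b, rfl⟩ := hy
      exact ⟨a * b, map_mul γ a b⟩
  have : IsIso (CommRingCat.ofHom γ) :=
    (ConcreteCategory.isIso_iff_bijective (CommRingCat.ofHom γ)).mpr ⟨hγi, hγs⟩
  refine ⟨Spec.map (CommRingCat.ofHom γ) ≫ Proj.awayι 𝒜 f hf one_pos, inferInstance, ?_⟩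
  rw [projToSpec, Category.assoc, Proj.awayι_toSpecZero_assoc, specToSpec, ← Spec.map_comp,
    ← Spec.map_comp]
  congr 1
  ext c
  exact hγk c

section

open Limits MvPolynomial

attribute [local instance] MvPolynomial.gradedAlgebra

theorem exists_isOpenImmersion_projectiveLine (k : Type u) [Field k] :
    ∃ j : Spec (.of (Polynomial k)) ⟶ projectiveLine k, IsOpenImmersion j ∧
      j ≫ projectiveLineToSpec k = Scheme.specToSpec k (.of (Polynomial k)) := by
  refine exists_isOpenImmersion_proj _ (X_mem k 1) (aeval ![Polynomial.X, 1]) (by simp) ?_ ?_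
  · intro n a ha h0
    rw [← Polynomial.homogenize_eq_of_isHomogeneous (ha : a.IsHomogeneous n) h0]
    simp
  · rw [eq_top_iff, ← Polynomial.adjoin_X]
    refine Algebra.adjoin_mono (Set.singleton_subset_iff.mpr ⟨X 0, X_mem k 0, by simp⟩)

end

theorem MvPolynomial.IsHomogeneous.aeval_mul {σ R S : Type*} [CommSemiring R] [CommSemiring S]
    [Algebra R S] {p : MvPolynomial σ R} {n : ℕ} (hp : p.IsHomogeneous n) (c : S) (v : σ → S) :
    MvPolynomial.aeval (fun i => c * v i) p = c ^ n * MvPolynomial.aeval v p := by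
  rw [aeval_def, aeval_def, eval₂_eq, eval₂_eq, Finset.mul_sum]
  refine Finset.sum_congr rfl fun d hd => ?_
  have h : ∑ i ∈ d.support, d i = n := by
    by_contra h
    exact mem_support_iff.mp hd (hp.coeff_eq_zero h)
  rw [← h, ← Finset.prod_pow_eq_pow_sum]
  simp only [mul_pow, Finset.prod_mul_distrib]
  ring

namespace WeierstrassCurve

open MvPolynomial

variable {k : Type u} [Field k] (W : WeierstrassCurve k)

theorem aeval_projectivePolynomial {L : Type*} [CommRing L] [Algebra k L] (x y z : L) :
    aeval ![x, y, z] W.toProjective.polynomial =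
      y ^ 2 * z + algebraMap k L W.a₁ * x * y * z + algebraMap k L W.a₃ * y * z ^ 2 -
        (x ^ 3 + algebraMap k L W.a₂ * x ^ 2 * z + algebraMap k L W.a₄ * x * z ^ 2 +
          algebraMap k L W.a₆ * z ^ 3) := by
  simp [Projective.polynomial, ← algebraMap_eq]

theorem equation_iff_aeval_projectivePolynomial {L : Type*} [CommRing L] [Algebra k L] (x y : L) :
    (W.baseChange L).toAffine.Equation x y ↔
      aeval ![x, y, 1] W.toProjective.polynomial = 0 := by
  rw [Affine.equation_iff', aeval_projectivePolynomial]
  simp only [one_pow, mul_one]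
  rfl

/-- The coordinate functions of the affine part of the curve satisfy the dehomogenized equation. -/
theorem aeval_coordinateRing :
    aeval ![AdjoinRoot.of W.toAffine.polynomial Polynomial.X,
      AdjoinRoot.root W.toAffine.polynomial, (1 : W.toAffine.CoordinateRing)]
      W.toProjective.polynomial = 0 := by
  rw [← equation_iff_aeval_projectivePolynomial, ← Affine.eval₂_polynomial]
  have h : ((Polynomial.aeval (AdjoinRoot.of W.toAffine.polynomial Polynomial.X) :
      Polynomial k →ₐ[k] W.toAffine.CoordinateRing) :
      Polynomial k →+* W.toAffine.CoordinateRing) = AdjoinRoot.of W.toAffine.polynomial := by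
    ext
    · simp
      rfl
    · simp
  rw [h]
  exact AdjoinRoot.eval₂_root _

/-- The substitution `X ↦ X`, `Y ↦ Y`, `Z ↦ 1`, from the homogeneous coordinate ring to the
coordinate ring of the affine part. -/
noncomputable def setZOne : W.HomogeneousCoordinateRing →ₐ[k] W.toAffine.CoordinateRing :=
  Ideal.Quotient.liftₐ _ (aeval ![AdjoinRoot.of W.toAffine.polynomial Polynomial.X,
    AdjoinRoot.root W.toAffine.polynomial, 1]) fun a ha => by
      obtain ⟨b, rfl⟩ := Ideal.mem_span_singleton.mp ha
      rw [map_mul, aeval_coordinateRing, zero_mul]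

theorem setZOne_mk (p : MvPolynomial (Fin 3) k) :
    W.setZOne (Ideal.Quotient.mkₐ k _ p) = aeval ![AdjoinRoot.of W.toAffine.polynomial Polynomial.X,
      AdjoinRoot.root W.toAffine.polynomial, 1] p := rfl

/-- Dehomogenization is injective on each homogeneous part. On the localization at `Z`, it is undone
by `X ↦ X / Z`, `Y ↦ Y / Z`, up to a power of `Z`. -/
theorem eq_zero_of_setZOne_eq_zero {n : ℕ} {a : W.HomogeneousCoordinateRing}
    (ha : a ∈ W.homogeneousPart n) (h0 : W.setZOne a = 0) : a = 0 := by
  obtain ⟨p, hp, rfl⟩ := ha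
  have hp : p.IsHomogeneous n := hp
  change W.setZOne (Ideal.Quotient.mkₐ k _ p) = 0 at h0
  change Ideal.Quotient.mkₐ k _ p = 0
  rw [setZOne_mk] at h0
  let Q := FractionRing W.HomogeneousCoordinateRing
  let π : MvPolynomial (Fin 3) k →ₐ[k] Q :=
    (Algebra.algHom k W.HomogeneousCoordinateRing Q).comp (Ideal.Quotient.mkₐ k _)
  have hinj := IsFractionRing.injective W.HomogeneousCoordinateRing Q
  have hz : π (X 2) ≠ 0 := fun h => W.mk_Z_ne_zero (hinj (h.trans (map_zero _).symm))
  let v : Fin 3 → Q := ![π (X 0) / π (X 2), π (X 1) / π (X 2), 1]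
  have hv (q : MvPolynomial (Fin 3) k) : aeval (fun i => π (X 2) * v i) q = π q := by
    have h : (fun i => π (X 2) * v i) = fun i => π (X i) := by
      funext i
      fin_cases i
      · exact mul_div_cancel₀ _ hz
      · exact mul_div_cancel₀ _ hz
      · exact mul_one _
    rw [h]
    rw [← comp_aeval_apply, aeval_X_left_apply]
  have hF : aeval v W.toProjective.polynomial = 0 := by
    have h := W.isHomogeneous_projectivePolynomial.aeval_mul (π (X 2)) v
    have h1 : π W.toProjective.polynomial = 0 := by
      have h2 : Ideal.Quotient.mkₐ k (Ideal.span {W.toProjective.polynomial})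
          W.toProjective.polynomial = 0 :=
        Ideal.Quotient.eq_zero_iff_mem.mpr (Ideal.mem_span_singleton_self _)
      rw [AlgHom.comp_apply, h2, map_zero]
    rw [hv, h1] at h
    exact (mul_eq_zero_iff_left (pow_ne_zero 3 hz)).mp h.symm
  let ψ : W.toAffine.CoordinateRing →ₐ[k] Q :=
    AdjoinRoot.liftAlgHom W.toAffine.polynomial (Polynomial.aeval (v 0)) (v 1)
      ((Affine.eval₂_polynomial (W := W.toAffine) (v 0) (v 1)).mpr
        ((W.equation_iff_aeval_projectivePolynomial _ _).mpr hF))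
  have hψ : ψ.comp (aeval ![AdjoinRoot.of W.toAffine.polynomial Polynomial.X,
      AdjoinRoot.root W.toAffine.polynomial, 1]) = aeval v := by
    ext i
    rw [AlgHom.comp_apply, aeval_X, aeval_X]
    fin_cases i
    · exact (AdjoinRoot.liftAlgHom_of _ _ _ _ _).trans (Polynomial.aeval_X _)
    · exact AdjoinRoot.liftAlgHom_root _ _ _ _
    · exact map_one ψ
  apply hinj
  rw [map_zero]
  change π p = 0
  have h1 := DFunLike.congr_fun hψ p
  rw [AlgHom.comp_apply, h0, map_zero] at h1
  rw [← hv, hp.aeval_mul, ← h1, mul_zero]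

theorem exists_isOpenImmersion_projectiveCurve :
    ∃ j : Spec (.of W.toAffine.CoordinateRing) ⟶ W.projectiveCurve, IsOpenImmersion j ∧
      j ≫ W.projectiveCurveToSpec = Scheme.specToSpec k (.of W.toAffine.CoordinateRing) := by
  have hmem (i : Fin 3) : Ideal.Quotient.mkₐ k _ (X i) ∈ W.homogeneousPart 1 :=
    ⟨X i, isHomogeneous_X _ _, rfl⟩
  refine exists_isOpenImmersion_proj _ (hmem 2) W.setZOne ?_
    (fun n a ha h0 => W.eq_zero_of_setZOne_eq_zero ha h0) ?_
  · rw [setZOne_mk, aeval_X]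
    rfl
  · have hX : AdjoinRoot.of W.toAffine.polynomial Polynomial.X ∈
        Algebra.adjoin k (W.setZOne '' W.homogeneousPart 1) :=
      Algebra.subset_adjoin ⟨_, hmem 0, (W.setZOne_mk _).trans (aeval_X _ _)⟩
    have hY : AdjoinRoot.root W.toAffine.polynomial ∈
        Algebra.adjoin k (W.setZOne '' W.homogeneousPart 1) :=
      Algebra.subset_adjoin ⟨_, hmem 1, (W.setZOne_mk _).trans (aeval_X _ _)⟩
    rw [eq_top_iff]
    rintro y -
    obtain ⟨p, rfl⟩ := AdjoinRoot.mk_surjective y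
    induction p using Polynomial.induction_on' with
    | add p q hp hq =>
      rw [map_add]
      exact add_mem hp hq
    | monomial n a =>
      rw [← Polynomial.C_mul_X_pow_eq_monomial, map_mul, map_pow, AdjoinRoot.mk_X, AdjoinRoot.mk_C]
      refine mul_mem ?_ (pow_mem hY n)
      induction a using Polynomial.induction_on' with
      | add p q hp hq =>
        rw [map_add]
        exact add_mem hp hq
      | monomial n a =>
        rw [← Polynomial.C_mul_X_pow_eq_monomial, map_mul, map_pow]
        exact mul_mem (Subalgebra.algebraMap_mem _ a) (pow_mem hX n)

end WeierstrassCurve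

/-- The fraction field of `A[X]` is also the fraction field of `K[X]`, for `K` the fraction field of
`A`. -/
theorem exists_algebra_polynomial_fractionRing (k A K : Type u) [Field k] [CommRing A] [IsDomain A]
    [Algebra k A] [Field K] [Algebra A K] [IsFractionRing A K] [Algebra k K] [IsScalarTower k A K] :
    ∃ _ : Algebra (Polynomial K) (FractionRing (Polynomial A)),
      IsFractionRing (Polynomial K) (FractionRing (Polynomial A)) ∧
      IsScalarTower k (Polynomial K) (FractionRing (Polynomial A)) := by
  let _ := Polynomial.algebra A K
  let T := FractionRing (Polynomial A)
  let M := (nonZeroDivisors A).map (Polynomial.C : A →+* Polynomial A)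
  have : IsLocalization M (Polynomial K) := Polynomial.isLocalization (nonZeroDivisors A) K
  have hM (y : M) : IsUnit (algebraMap (Polynomial A) T y) := by
    obtain ⟨_, a, ha, rfl⟩ := y
    rw [isUnit_iff_ne_zero, Ne, map_eq_zero_iff _ (IsFractionRing.injective (Polynomial A) T)]
    exact Polynomial.C_ne_zero.mpr (nonZeroDivisors.ne_zero ha)
  let _ : Algebra (Polynomial K) T := (IsLocalization.lift hM).toAlgebra
  have hT (p) : algebraMap (Polynomial K) T (algebraMap _ _ p) = algebraMap (Polynomial A) T p :=
    IsLocalization.lift_eq hM p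
  have : IsScalarTower (Polynomial A) (Polynomial K) T := .of_algebraMap_eq fun p => (hT p).symm
  refine ⟨inferInstance, IsFractionRing.isFractionRing_of_isDomain_of_isLocalization M _ _,
    .of_algebraMap_eq fun c => ?_⟩
  rw [IsScalarTower.algebraMap_apply k (Polynomial A) T, ← hT]
  congr 1
  change Polynomial.map (algebraMap A K) (Polynomial.C (algebraMap k A c)) =
    Polynomial.C (algebraMap k K c)
  rw [Polynomial.map_C, ← IsScalarTower.algebraMap_apply]

section

open Limits

variable {k : Type u} [Field k]

/-- The product of an affine chart `Spec A` of `X` with the affine line is a chart of the product of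
`X` with the projective line. -/
theorem exists_isOpenImmersion_pullback_projectiveLine {A : Type u} [CommRing A] [Algebra k A]
    {X : Scheme.{u}} {s : X ⟶ Spec (.of k)} (j₁ : Spec (.of A) ⟶ X) [IsOpenImmersion j₁]
    (h₁ : j₁ ≫ s = Scheme.specToSpec k (.of A)) :
    ∃ j : Spec (.of (Polynomial A)) ⟶ pullback s (projectiveLineToSpec k),
      IsOpenImmersion j ∧ j ≫ pullback.fst _ _ ≫ s = Scheme.specToSpec k (.of (Polynomial A)) := by
  obtain ⟨j₂, hj₂, h₂⟩ := exists_isOpenImmersion_projectiveLine k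
  let _ := Polynomial.algebra k A
  have h : IsPullback _ _ (Scheme.specToSpec k (.of A))
      (Scheme.specToSpec k (.of (Polynomial k))) :=
    isPullback_SpecMap_of_isPushout _ _ _ _
      (CommRingCat.isPushout_of_isPushout k A (Polynomial k) (Polynomial A))
  let j : pullback (Scheme.specToSpec k (.of A)) (Scheme.specToSpec k (.of (Polynomial k))) ⟶
      pullback s (projectiveLineToSpec k) :=
    pullback.map _ _ _ _ j₁ j₂ (𝟙 _) (by simp [h₁]) (by simp [h₂])
  have : IsOpenImmersion j := inferInstance
  refine ⟨h.isoPullback.hom ≫ j, inferInstance, ?_⟩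
  rw [Category.assoc, pullback.lift_fst_assoc, Category.assoc, h₁, h.isoPullback_hom_fst_assoc,
    Scheme.specToSpec, Scheme.specToSpec, ← Spec.map_comp]
  rfl

end

theorem WeierstrassCurve.exists_isOpenImmersion_prodProjectiveLine {k : Type u} [Field k]
    (W : WeierstrassCurve k) :
    ∃ j : Spec (.of (Polynomial W.toAffine.CoordinateRing)) ⟶ W.prodProjectiveLine,
      IsOpenImmersion j ∧ j ≫ W.prodProjectiveLineToSpec =
        Scheme.specToSpec k (.of (Polynomial W.toAffine.CoordinateRing)) := by
  obtain ⟨j, hj, h⟩ := W.exists_isOpenImmersion_projectiveCurve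
  exact exists_isOpenImmersion_pullback_projectiveLine j h

/-! ### The conclusion -/

namespace WeierstrassCurve

/-- Translations by torsion points give large groups `ℤ / n × ℤ / n` of automorphisms of the function
field. -/
theorem exists_injective_zmod_functionField {k : Type u} [Field k] [IsAlgClosed k] [CharZero k]
    (W : WeierstrassCurve k) [W.IsElliptic] (N : ℕ) :
    ∃ n > N, ∃ ρ : Multiplicative (ZMod n × ZMod n) →*
      (W.toAffine.FunctionField ≃ₐ[k] W.toAffine.FunctionField), Function.Injective ρ := by
  classical
  obtain ⟨f, hf⟩ := Affine.exists_injective_zmod_two_pow two_ne_zero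
    (W.toAffine.baseChange k).toAffine N
  obtain ⟨t, ht⟩ := Affine.exists_injective_translation W.toAffine
  exact ⟨2 ^ (N + 1), (Nat.lt_succ_self N).trans Nat.lt_two_pow_self,
    t.comp (AddMonoidHom.toMultiplicative f), ht.comp hf⟩

end WeierstrassCurve

/-- For an elliptic curve `E` over an algebraically closed field `k` of characteristic zero, the group
of birational automorphisms of `E × ℙ¹` over `k` is not a Jordan group. -/
theorem theorem1p1 {k : Type u} [Field k] [IsAlgClosed k] [CharZero k] (W : WeierstrassCurve k)
    [W.IsElliptic] : ¬ IsJordanGroup (Bir W.prodProjectiveLineToSpec) := by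
  let A := W.toAffine.CoordinateRing
  let K := W.toAffine.FunctionField
  have : Module.Finite (Polynomial k) A :=
    .of_basis (WeierstrassCurve.Affine.CoordinateRing.basis _)
  have : Algebra.FiniteType k A := .trans (S := Polynomial k) inferInstance inferInstance
  have : Algebra.FiniteType k (Polynomial A) := .trans (S := A) inferInstance inferInstance
  obtain ⟨_, _, _⟩ := exists_algebra_polynomial_fractionRing k A K
  obtain ⟨j, hj, h⟩ := W.exists_isOpenImmersion_prodProjectiveLine
  obtain ⟨f, hf⟩ := exists_injective_bir (L := FractionRing (Polynomial A)) j h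
  exact fun hJ => not_isJordanGroup_algEquiv (K := K) W.toAffine.trdeg_functionField
    W.exists_injective_zmod_functionField (.of_injective f hf hJ)
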